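/- For $n\in\mathbb N$ and $r>0$ let $\mathcal T(n,r)$ be the random geometric graph whose $n$ vertices are independent uniform random points of the square $[0,\sqrt n]^2$, two distinct vertices being adjacent when their distance $d_T$ in the torus $T_n=\mathbb R^2/(\sqrt n\,\mathbb Z)^2$ is at most $r$. The localization game on a graph $G$ is played in rounds. In each round the cops first choose a set of vertices (sensors). The robber, who sees the sensors, then moves to a neighbour of her current vertex or stays put (in the first round she chooses any vertex). Finally the cops learn the graph distances from all sensors of this round to the robber. The robber is detected in a round if the information that the cops have gathered up to and including that round determines her current vertex, that is, if only one vertex is the endpoint of a sequence of legal moves consistent with all the observed distances. **Theorem.** Let $r=r(n)$ satisfy $\log n\le r(n)<\sqrt n/4$ for all sufficiently large $n$, let $G\in\mathcal T(n,r)$, and let $\mathcal B_R$ be the closed ball of radius $r/3$ about the centre of the square $[0,\sqrt n]^2$. Then, with probability tending to $1$ as $n\to\infty$, the robber has a strategy in the localization game on $G$ with which she occupies a vertex in $\mathcal B_R$ in every round and is never detected, against all choices of the cops in which every round uses fewer than $$10^{-4}\,\frac{r^{4/3}}{(\log n)^{1/3}}$$ sensors. -/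

import Mathlib

open MeasureTheory ProbabilityTheory Filter Topology

noncomputable section

namespace LocalizationGame

/-! ### The localization game on a graph -/

section Game

variable {V : Type*}

/-- Two vertices have the same `S`-signature: they are at the same graph distance from every
sensor of `S` (the distance between vertices of different components is `⊤`). -/
def SameSignature (G : SimpleGraph V) (S : Finset V) (u v : V) : Prop :=
  ∀ s ∈ S, G.edist s u = G.edist s v

/-- The closed neighbourhood `N[A]` of a set of vertices. -/
def closedNbhd (G : SimpleGraph V) (A : Set V) : Set V :=
  {u | ∃ a ∈ A, u = a ∨ G.Adj a u}

/-- `candidates G S w i` is the set of vertices at which the robber can be after round `i`, given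
what the cops know: the graph, the rules, and the distances observed in rounds `0, …, i` when the
sensors are placed on `S 0, S 1, …` and the robber visits `w 0, w 1, …`. -/
def candidates (G : SimpleGraph V) (S : ℕ → Finset V) (w : ℕ → V) : ℕ → Set V
  | 0 => {u | SameSignature G (S 0) u (w 0)}
  | i + 1 => {u | u ∈ closedNbhd G (candidates G S w i) ∧
      SameSignature G (S (i + 1)) u (w (i + 1))}

/-- The position of the robber in round `i` if she follows the strategy `σ`, which maps the list
of sensor sets placed so far (those of the current round included) to a vertex. -/
def position (σ : List (Finset V) → V) (S : ℕ → Finset V) (i : ℕ) : V :=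
  σ ((List.range (i + 1)).map S)

/-- The robber has a strategy with which she stays in the vertex set `A` and is never located,
however the cops place fewer than `K` sensors in each round. -/
def RobberEvadesIn (G : SimpleGraph V) (K : ℝ) (A : Set V) : Prop :=
  ∃ σ : List (Finset V) → V, ∀ S : ℕ → Finset V, (∀ i, ((S i).card : ℝ) < K) →
    (∀ i, position σ S (i + 1) = position σ S i ∨
      G.Adj (position σ S i) (position σ S (i + 1))) ∧
    (∀ i, position σ S i ∈ A) ∧
    (∀ i, (candidates G S (position σ S) i).Nontrivial)

end Game

/-! ### The random geometric graph on the torus -/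

/-- The distance on the torus `ℝ² / (L ℤ)²` induced by the Euclidean distance. The norm on
`AddCircle L` is the distance to the nearest multiple of `L`. -/
def torusDist (L : ℝ) (x y : ℝ × ℝ) : ℝ :=
  Real.sqrt (‖((x.1 - y.1 : ℝ) : AddCircle L)‖ ^ 2 + ‖((x.2 - y.2 : ℝ) : AddCircle L)‖ ^ 2)

/-- The geometric graph on the torus with vertex positions `x` and threshold distance `r`. -/
def torusGraph (L r : ℝ) {n : ℕ} (x : Fin n → ℝ × ℝ) : SimpleGraph (Fin n) where
  Adj i j := i ≠ j ∧ torusDist L (x i) (x j) ≤ r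
  symm := ⟨fun i j h => ⟨h.1.symm, by
    have e : torusDist L (x j) (x i) = torusDist L (x i) (x j) := by
      unfold torusDist
      rw [← norm_neg ((((x j).1 - (x i).1 : ℝ)) : AddCircle L),
        ← norm_neg ((((x j).2 - (x i).2 : ℝ)) : AddCircle L),
        ← AddCircle.coe_neg, ← AddCircle.coe_neg, neg_sub, neg_sub]
    rw [e]; exact h.2⟩⟩
  loopless := ⟨fun _ h => h.1 rfl⟩

/-- The square `[0, √n]²`. -/
def square (n : ℕ) : Set (ℝ × ℝ) :=
  Set.Icc 0 (Real.sqrt n) ×ˢ Set.Icc 0 (Real.sqrt n)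

/-- The law of `n` independent points, each uniform in `[0, √n]²`. -/
def pointsLaw (n : ℕ) : Measure (Fin n → ℝ × ℝ) :=
  Measure.pi fun _ => (volume : Measure (ℝ × ℝ))[|square n]

/-- The vertices whose position is in the closed ball of radius `ρ` at the centre of the square. -/
def centralBall (ρ : ℝ) {n : ℕ} (x : Fin n → ℝ × ℝ) : Set (Fin n) :=
  {i | torusDist (Real.sqrt n) (x i) (Real.sqrt n / 2, Real.sqrt n / 2) ≤ ρ}

end LocalizationGame

end

/-!
The vertices in a square of side `2r/5` around the centre, the core, form a clique, so the robber
can reach each of them from any other in a single move. She therefore ignores the past, and only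
has to find, in each round, two core vertices with the same distances from the current sensors.

The distances from a sensor outside the core to the core vertices take at most two consecutive
values. Which one is taken at a vertex depends on whether its position lies in the union of the
discs of radius `r` about certain vertices outside the core. Subdivide the core into `N²` cells.
Each such union cuts only `O(N)` cells: a disc that enters a cell in one of the four axis
directions covers what lies further in this direction, so only three cells of each row or column
are cut in this way. If there are `m ≤ N / 24` sensors, then at least half of the cells are
cut by none of the unions, and two core vertices in the same uncut cell cannot be distinguished.

It remains to find such a pair simultaneously for all placements of the sensors. Conditionally on
the points outside the core, the points in the core are independent and uniform, and with high
probability there are at least `M ≈ r²/20` of them besides the sensors. The probability that no two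
of them share an uncut cell is at most `exp (-M(M - 1) / (16N²))`, while the sensors and their
distances from the core can be chosen in at most `n ^ (2m)` ways. With `m` and `N` of order
`r^(4/3) / (log n)^(1/3)`, both `M² / N²` and `m log n` are of order `r^(4/3) (log n)^(2/3)`, and
with the constants at hand the first one wins.
-/

noncomputable section

namespace LocalizationGame

section Graph

variable {V : Type*} {G : SimpleGraph V} {I A B : Set V}

/-- `S` resolves `B` if different vertices of `B` have different `S`-signatures: the notion of
resolving set from metric dimension, relative to `B`. -/
def Resolves (G : SimpleGraph V) (S : Finset V) (B : Set V) : Prop :=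
  ∀ u ∈ B, ∀ v ∈ B, SameSignature G S u v → u = v

theorem SameSignature.refl (S : Finset V) (u : V) : SameSignature G S u u :=
  fun _ _ => rfl

theorem eq_or_adj_of_isClique (hB : G.IsClique B) {u v : V} (hu : u ∈ B) (hv : v ∈ B) :
    v = u ∨ G.Adj u v :=
  (eq_or_ne v u).imp_right fun h => hB hu hv h.symm

theorem position_getLast (f : Finset V → V) (S : ℕ → Finset V) :
    position (fun l => f (l.getLast?.getD ∅)) S = f ∘ S := by
  funext i
  simp [position, List.range_succ]

theorem mem_candidates_of_isClique (hB : G.IsClique B) {S : ℕ → Finset V} {w : ℕ → V}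
    (hw : ∀ i, w i ∈ B) (i : ℕ) {u : V} (hu : u ∈ B) (hs : SameSignature G (S i) u (w i)) :
    u ∈ candidates G S w i := by
  induction i generalizing u with
  | zero => exact hs
  | succ i ih =>
    exact ⟨⟨w i, ih (hw i) (.refl _ _), eq_or_adj_of_isClique hB (hw i) hu⟩, hs⟩

/-- In a clique the robber can reach any vertex in one move, so she only has to avoid being
located by the sensors of the current round. -/
theorem RobberEvadesIn.of_isClique [Nonempty V] {K : ℝ} (hBA : B ⊆ A) (hB : G.IsClique B)
    (h : ∀ S : Finset V, (S.card : ℝ) < K → ¬ Resolves G S B) : RobberEvadesIn G K A := by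
  have hex : ∀ S : Finset V, ∃ u : V, (S.card : ℝ) < K →
      u ∈ B ∧ ∃ v ∈ B, SameSignature G S v u ∧ v ≠ u := by
    intro S
    by_cases hS : (S.card : ℝ) < K
    · have hres := h S hS
      simp only [Resolves, not_forall, exists_prop] at hres
      obtain ⟨v, hv, u, hu, hsig, hne⟩ := hres
      exact ⟨u, fun _ => ⟨hu, v, hv, hsig, hne⟩⟩
    · exact ⟨Classical.arbitrary V, fun h => absurd h hS⟩
  choose f hf using hex
  refine ⟨fun l => f (l.getLast?.getD ∅), fun S hS => ?_⟩
  rw [position_getLast]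
  have hmem : ∀ i, (f ∘ S) i ∈ B := fun i => (hf (S i) (hS i)).1
  refine ⟨fun i => eq_or_adj_of_isClique hB (hmem i) (hmem (i + 1)), fun i => hBA (hmem i),
    fun i => ?_⟩
  obtain ⟨hu, v, hv, hsig, hne⟩ := hf (S i) (hS i)
  exact ⟨v, mem_candidates_of_isClique hB hmem i hv hsig,
    f (S i), mem_candidates_of_isClique hB hmem i hu (.refl _ _), hne⟩

/-- The vertices that can be reached from `s` by a path with fewer than `k` edges, none of which
meets `I`. -/
def outerBall (G : SimpleGraph V) (I : Set V) (s : V) (k : ℕ∞) : Set V :=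
  (G.induce Iᶜ).spanningCoe.ball s k

theorem spanningCoe_induce_adj {J : Set V} {u v : V} :
    (G.induce J).spanningCoe.Adj u v ↔ u ∈ J ∧ v ∈ J ∧ G.Adj u v := by
  simp [SimpleGraph.map_adj, and_left_comm]

theorem notMem_of_mem_outerBall {s v : V} {k : ℕ∞} (hs : s ∉ I) (hv : v ∈ outerBall G I s k) :
    v ∉ I := by
  obtain ⟨p⟩ := SimpleGraph.reachable_of_edist_ne_top (ne_top_of_lt hv)
  cases p with
  | nil => exact hs
  | cons hadj _ => exact (spanningCoe_induce_adj.1 hadj).1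

theorem edist_lt_of_mem_outerBall {s v : V} {k : ℕ∞} (hv : v ∈ outerBall G I s k) :
    G.edist v s < k :=
  (SimpleGraph.edist_anti (G.spanningCoe_induce_le _)).trans_lt hv

theorem mem_outerBall_of_edist_lt {s v : V} {k : ℕ∞} (hI : ∀ i ∈ I, k ≤ G.edist i s)
    (hv : G.edist v s < k) : v ∈ outerBall G I s k := by
  classical
  obtain ⟨p, hp⟩ := SimpleGraph.exists_walk_of_edist_ne_top (ne_top_of_lt hv)
  have hsupp : ∀ u ∈ p.support, u ∉ I := by
    intro u hu huI
    have hle : (p.dropUntil u hu).length ≤ p.length := p.length_dropUntil_le_length hu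
    have : G.edist u s ≤ G.edist v s :=
      hp ▸ (SimpleGraph.edist_le _).trans (by exact_mod_cast hle)
    exact absurd (hI u huI) (this.trans_lt hv).not_ge
  have hedges : ∀ e ∈ p.edges, e ∈ (G.induce Iᶜ).spanningCoe.edgeSet := by
    refine Sym2.ind fun a b he => ?_
    exact spanningCoe_induce_adj.2 ⟨hsupp a (p.fst_mem_support_of_mem_edges he),
      hsupp b (p.snd_mem_support_of_mem_edges he), p.adj_of_mem_edges he⟩
  refine (SimpleGraph.edist_le (p.transfer _ hedges)).trans_lt ?_
  rwa [SimpleGraph.Walk.length_transfer, hp]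

theorem edist_le_edist_add_one (hI : G.IsClique I) {i j : V} (hi : i ∈ I) (hj : j ∈ I) (s : V) :
    G.edist j s ≤ G.edist i s + 1 := by
  have hji : G.edist j i ≤ 1 :=
    SimpleGraph.edist_le_one_iff_adj_or_eq.2
      ((eq_or_adj_of_isClique hI hj hi).symm.imp_right Eq.symm)
  calc G.edist j s ≤ G.edist j i + G.edist i s := SimpleGraph.edist_triangle
    _ ≤ 1 + G.edist i s := add_le_add_left hji _
    _ = G.edist i s + 1 := add_comm _ _

theorem edist_eq_iff_exists_adj_outerBall {s i : V} {k : ℕ} (hs : s ∉ I)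
    (hI : ∀ i ∈ I, k ≤ G.edist i s) (hi : i ∈ I) :
    G.edist i s = k ↔ ∃ w ∈ outerBall G I s k, G.Adj w i := by
  constructor
  · intro hk
    obtain ⟨p, hp⟩ := SimpleGraph.exists_walk_of_edist_eq_coe hk
    cases p with
    | nil => exact absurd hi hs
    | @cons _ w _ hadj q =>
      refine ⟨w, mem_outerBall_of_edist_lt hI ?_, hadj.symm⟩
      refine (SimpleGraph.edist_le q).trans_lt ?_
      rw [← hp, SimpleGraph.Walk.length_cons]
      exact_mod_cast q.length.lt_succ_self
  · rintro ⟨w, hw, hadj⟩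
    refine le_antisymm ?_ (hI i hi)
    calc G.edist i s ≤ G.edist i w + G.edist w s := SimpleGraph.edist_triangle
      _ = G.edist w s + 1 := by
        rw [SimpleGraph.edist_eq_one_iff_adj.2 hadj.symm, add_comm]
      _ ≤ k := Order.add_one_le_of_lt (edist_lt_of_mem_outerBall hw)

theorem edist_lt_card_of_ne_top [Fintype V] {u v : V} (h : G.edist u v ≠ ⊤) :
    G.edist u v < Fintype.card V := by
  obtain ⟨p, hp, hlen⟩ := (SimpleGraph.reachable_of_edist_ne_top h).exists_path_of_dist
  rw [← (SimpleGraph.reachable_of_edist_ne_top h).coe_dist_eq_edist, ← hlen]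
  exact_mod_cast hp.length_lt

/-- The distances from `s` to a clique take at most two values, `k` and `k + 1`, so it is enough to
know where the smaller one is attained. -/
theorem exists_outerBall_imp_edist_eq [Fintype V] (hI : G.IsClique I) {s : V} (hs : s ∉ I) :
    ∃ k < Fintype.card V, ∀ i ∈ I, ∀ j ∈ I,
      ((∃ w ∈ outerBall G I s k, G.Adj w i) ↔ ∃ w ∈ outerBall G I s k, G.Adj w j) →
      G.edist i s = G.edist j s := by
  by_cases htop : ∀ i ∈ I, G.edist i s = ⊤
  · exact ⟨0, Fintype.card_pos_iff.2 ⟨s⟩, fun i hi j hj _ => (htop i hi).trans (htop j hj).symm⟩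
  push Not at htop
  obtain ⟨i₁, hi₁, hfin⟩ := htop
  obtain ⟨i₀, hi₀, hmin⟩ := Set.exists_min_image I (G.edist · s) I.toFinite ⟨i₁, hi₁⟩
  have hfin₀ : G.edist i₀ s ≠ ⊤ := ne_top_of_le_ne_top hfin (hmin i₁ hi₁)
  obtain ⟨k, hk⟩ := ENat.ne_top_iff_exists.1 hfin₀
  have hkcard : k < Fintype.card V := by
    exact_mod_cast hk ▸ edist_lt_card_of_ne_top hfin₀
  rw [← hk] at hmin
  have hval : ∀ i ∈ I, G.edist i s = k ∨ G.edist i s = k + 1 := by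
    intro i hi
    refine (hmin i hi).eq_or_lt.imp Eq.symm fun hlt => le_antisymm ?_ (Order.add_one_le_of_lt hlt)
    exact hk ▸ edist_le_edist_add_one hI hi₀ hi s
  refine ⟨k, hkcard, fun i hi j hj hij => ?_⟩
  rw [← edist_eq_iff_exists_adj_outerBall hs hmin hi,
    ← edist_eq_iff_exists_adj_outerBall hs hmin hj] at hij
  rcases hval i hi with h | h <;> rcases hval j hj with h' | h' <;> grind

theorem exists_outerBall_imp_sameSignature [Fintype V] (hI : G.IsClique I) (S : Finset V) :
    ∃ k : V → ℕ, (∀ s, k s < Fintype.card V) ∧ ∀ i ∈ I, i ∉ S → ∀ j ∈ I, j ∉ S →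
      (∀ s ∈ S, s ∉ I →
        ((∃ w ∈ outerBall G I s (k s), G.Adj w i) ↔ ∃ w ∈ outerBall G I s (k s), G.Adj w j)) →
      SameSignature G S i j := by
  have hex : ∀ s, ∃ k < Fintype.card V, s ∉ I → ∀ i ∈ I, ∀ j ∈ I,
      ((∃ w ∈ outerBall G I s k, G.Adj w i) ↔ ∃ w ∈ outerBall G I s k, G.Adj w j) →
      G.edist i s = G.edist j s := by
    intro s
    by_cases hs : s ∈ I
    · exact ⟨0, Fintype.card_pos_iff.2 ⟨s⟩, fun h => absurd hs h⟩
    · obtain ⟨k, hk, h⟩ := exists_outerBall_imp_edist_eq hI hs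
      exact ⟨k, hk, fun _ => h⟩
  choose k hk hdist using hex
  refine ⟨k, hk, fun i hi hiS j hj hjS h s hs => ?_⟩
  by_cases hsI : s ∈ I
  · have hone : ∀ v ∈ I, v ∉ S → G.edist s v = 1 := fun v hv hvS =>
      SimpleGraph.edist_eq_one_iff_adj.2 (hI hsI hv (ne_of_mem_of_not_mem hs hvS))
    rw [hone i hi hiS, hone j hj hjS]
  · rw [G.edist_comm (u := s), G.edist_comm (u := s)]
    exact hdist s hsI i hi j hj (h s hs hsI)

end Graph

section Geometry

variable {o p q q' w : ℝ × ℝ} {ε r σ : ℝ} {N : ℕ} {C Q : Set (ℝ × ℝ)}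

/-- The closed Euclidean disc of radius `r` about `w`; the metric of `ℝ × ℝ` itself is the one of
the maximum norm. -/
def disc (r : ℝ) (w : ℝ × ℝ) : Set (ℝ × ℝ) :=
  {p | (w.1 - p.1) ^ 2 + (w.2 - p.2) ^ 2 ≤ r ^ 2}

/-- The set `U` cuts `Q` if it contains a part of `Q`, but not all of it. -/
def Cuts (U Q : Set (ℝ × ℝ)) : Prop :=
  (Q ∩ U).Nonempty ∧ (Q \ U).Nonempty

/-- The `a`-th of the consecutive half-open intervals of length `ε` that start at `t`. -/
def gridStrip (t ε : ℝ) (a : ℕ) : Set ℝ :=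
  Set.Ico (t + a * ε) (t + (a + 1) * ε)

/-- The cells of the `N × N` grid of half-open squares of side `ε` whose lower left corner
is `o`. -/
def gridCell (o : ℝ × ℝ) (ε : ℝ) (c : Fin N × Fin N) : Set (ℝ × ℝ) :=
  gridStrip o.1 ε c.1 ×ˢ gridStrip o.2 ε c.2

theorem abs_sub_le_of_mem_gridStrip {t s s' : ℝ} {a : ℕ} (hs : s ∈ gridStrip t ε a)
    (hs' : s' ∈ gridStrip t ε a) : |s - s'| ≤ ε := by
  obtain ⟨h₁, h₂⟩ := hs
  obtain ⟨h₁', h₂'⟩ := hs'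
  exact abs_le.2 ⟨by linarith, by linarith⟩

theorem two_mul_le_sub_of_mem_gridStrip {t s s' : ℝ} (hε : 0 ≤ ε) {a a' : ℕ} (ha : a + 3 ≤ a')
    (hs : s ∈ gridStrip t ε a) (hs' : s' ∈ gridStrip t ε a') : 2 * ε ≤ s' - s := by
  have ha' : ((a + 3 : ℕ) : ℝ) * ε ≤ a' * ε :=
    mul_le_mul_of_nonneg_right (by exact_mod_cast ha) hε
  push_cast at ha'
  linarith [hs.2, hs'.1]

theorem gridStrip_subset_Ico (t : ℝ) (hε : 0 ≤ ε) (a : Fin N) :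
    gridStrip t ε a ⊆ Set.Ico t (t + N * ε) := by
  have ha : ((a : ℕ) : ℝ) + 1 ≤ N := by exact_mod_cast a.isLt
  refine Set.Ico_subset_Ico (by simp only [le_add_iff_nonneg_right]; positivity) ?_
  gcongr

theorem gridStrip_pairwise_disjoint (t ε : ℝ) :
    Pairwise (Function.onFun Disjoint (gridStrip t ε)) := by
  have h := Set.pairwise_disjoint_Ico_add_zsmul t ε
  intro a b hab
  simpa [gridStrip, Function.onFun] using h (Nat.cast_injective.ne hab : (a : ℤ) ≠ b)

theorem gridCell_pairwise_disjoint (o : ℝ × ℝ) (ε : ℝ) :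
    Pairwise (Function.onFun Disjoint (gridCell (N := N) o ε)) := by
  intro c c' hcc
  rw [Function.onFun, gridCell, gridCell, Set.disjoint_prod]
  by_cases h : c.1 = c'.1
  · exact Or.inr (gridStrip_pairwise_disjoint _ _ fun h' => hcc (Prod.ext h (Fin.ext h')))
  · exact Or.inl (gridStrip_pairwise_disjoint _ _ (Fin.val_injective.ne h))

theorem measurableSet_gridCell (o : ℝ × ℝ) (ε : ℝ) (c : Fin N × Fin N) :
    MeasurableSet (gridCell o ε c) :=
  measurableSet_Ico.prod measurableSet_Ico

theorem gridCell_subset_prod_Ico (o : ℝ × ℝ) (hε : 0 ≤ ε) (c : Fin N × Fin N) :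
    gridCell o ε c ⊆ Set.Ico o.1 (o.1 + N * ε) ×ˢ Set.Ico o.2 (o.2 + N * ε) :=
  Set.prod_mono (gridStrip_subset_Ico _ hε _) (gridStrip_subset_Ico _ hε _)

/-- The centre of a disc is seen from its boundary at a distance of almost `r`, so moving towards
it by less than `r / 2`, in a direction that deviates by at most 45 degrees, leads into the disc.
Here `v` points to the centre, `d` out of the disc, and `(x, y)` to the new position. -/
theorem sq_add_sq_le_of_far {v₁ v₂ d₁ d₂ x y : ℝ} (hε : 0 < ε) (hεr : 100 * ε ≤ r)
    (hv : v₁ ^ 2 + v₂ ^ 2 ≤ r ^ 2) (hdir : |v₁| ≤ v₂)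
    (hd : r ^ 2 < (v₁ - d₁) ^ 2 + (v₂ - d₂) ^ 2) (hd₁ : |d₁| ≤ ε) (hd₂ : |d₂| ≤ ε)
    (hx : |x| ≤ ε) (hy : 2 * ε ≤ y) (hyr : y ≤ 2 * r / 5) :
    (v₁ - x) ^ 2 + (v₂ - y) ^ 2 ≤ r ^ 2 := by
  have hv₂ : (69 / 100) * r ≤ v₂ := by
    have h₁ : (v₁ - d₁) ^ 2 ≤ (v₂ + ε) ^ 2 := by
      refine sq_le_sq' ?_ ?_ <;> linarith [abs_le.1 hdir, abs_le.1 hd₁]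
    have h₂ : (v₂ - d₂) ^ 2 ≤ (v₂ + ε) ^ 2 := by
      refine sq_le_sq' ?_ ?_ <;> linarith [abs_le.1 hdir, abs_le.1 hd₂]
    by_contra! h
    nlinarith [abs_nonneg v₁]
  have hvx : -(v₁ * x) ≤ v₂ * ε := calc
    -(v₁ * x) ≤ |v₁| * |x| := abs_mul v₁ x ▸ neg_le_abs _
    _ ≤ v₂ * ε := mul_le_mul hdir hx (abs_nonneg x) ((abs_nonneg v₁).trans hdir)
  have hxε : x ^ 2 ≤ ε ^ 2 := sq_le_sq.2 (hx.trans (le_abs_self ε))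
  have hεy : v₂ * (2 * ε) ≤ v₂ * y :=
    mul_le_mul_of_nonneg_left hy ((abs_nonneg v₁).trans hdir)
  have hvy : (69 / 100) * r * y ≤ v₂ * y := by gcongr; linarith
  have hyy : y * y ≤ 2 * r / 5 * y := by gcongr; linarith
  have hεε : ε * ε ≤ r / 100 * y := by gcongr <;> linarith
  nlinarith

theorem mem_disc_of_far (hσ : |σ| = 1) (hε : 0 < ε) (hεr : 100 * ε ≤ r) (hp : p ∈ disc r w)
    (hq : q ∉ disc r w) (hdir : |w.1 - p.1| ≤ σ * (w.2 - p.2)) (hq₁ : |q.1 - p.1| ≤ ε)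
    (hq₂ : |q.2 - p.2| ≤ ε) (hq'₁ : |q'.1 - p.1| ≤ ε) (hfar : 2 * ε ≤ σ * (q'.2 - p.2))
    (hfar' : σ * (q'.2 - p.2) ≤ 2 * r / 5) : q' ∈ disc r w := by
  have hσσ : σ ^ 2 = 1 := by rw [← sq_abs, hσ, one_pow]
  have hsq : ∀ z : ℝ × ℝ, (w.1 - p.1 - (z.1 - p.1)) ^ 2 +
      (σ * (w.2 - p.2) - σ * (z.2 - p.2)) ^ 2 = (w.1 - z.1) ^ 2 + (w.2 - z.2) ^ 2 := fun z => by
    rw [← mul_sub, mul_pow, hσσ]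
    ring
  have hv : (w.1 - p.1) ^ 2 + (σ * (w.2 - p.2)) ^ 2 ≤ r ^ 2 := by
    rwa [mul_pow, hσσ, one_mul]
  have hq₂' : |σ * (q.2 - p.2)| ≤ ε := by rwa [abs_mul, hσ, one_mul]
  rw [disc, Set.mem_ofPred_eq, ← hsq]
  exact sq_add_sq_le_of_far hε hεr hv hdir (by rw [hsq]; exact not_le.1 hq) hq₁ hq₂' hq'₁ hfar
    hfar'

/-- A disc centred in `C` meets `Q`, which is not contained in the union of these discs, at a point
from which the centre of the disc is seen at an angle of at most 45 degrees to the upward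
(for `σ = 1`) or downward (for `σ = -1`) direction. -/
def CutsVertically (r σ : ℝ) (C Q : Set (ℝ × ℝ)) : Prop :=
  (∃ w ∈ C, ∃ p ∈ Q, p ∈ disc r w ∧ |w.1 - p.1| ≤ σ * (w.2 - p.2)) ∧
    (Q \ ⋃ w ∈ C, disc r w).Nonempty

theorem Cuts.exists_cutsVertically (h : Cuts (⋃ w ∈ C, disc r w) Q) :
    ∃ σ ∈ ({1, -1} : Set ℝ), CutsVertically r σ C Q ∨
      CutsVertically r σ (Prod.swap ⁻¹' C) (Prod.swap ⁻¹' Q) := by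
  obtain ⟨⟨p, hp, hpU⟩, q, hq, hqU⟩ := h
  simp only [Set.mem_iUnion, exists_prop, not_exists, not_and] at hpU hqU
  obtain ⟨w, hw, hpw⟩ := hpU
  have hsign : ∀ t : ℝ, ∃ σ ∈ ({1, -1} : Set ℝ), |t| = σ * t := fun t => by
    rcases abs_choice t with h | h
    · exact ⟨1, by simp, by rw [h, one_mul]⟩
    · exact ⟨-1, by simp, by rw [h, neg_one_mul]⟩
  have hswap : ∀ z w : ℝ × ℝ, z.swap ∈ disc r w ↔ z ∈ disc r w.swap := fun z w => by
    simp [disc, add_comm]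
  rcases le_total |w.1 - p.1| |w.2 - p.2| with hle | hle
  · obtain ⟨σ, hσ, habs⟩ := hsign (w.2 - p.2)
    refine ⟨σ, hσ, Or.inl ⟨⟨w, hw, p, hp, hpw, habs ▸ hle⟩, q, hq, ?_⟩⟩
    simpa using hqU
  · obtain ⟨σ, hσ, habs⟩ := hsign (w.1 - p.1)
    refine ⟨σ, hσ, Or.inr ⟨⟨w.swap, hw, p.swap, hp, ?_, habs ▸ hle⟩, q.swap, hq, ?_⟩⟩
    · simpa [hswap] using hpw
    · simp only [Set.mem_iUnion, exists_prop, not_exists, not_and]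
      intro w' hw'
      rw [hswap]
      exact hqU _ hw'

theorem ncard_le_of_column_bound {P : Fin N → Fin N → Prop}
    (hP : ∀ a b b', P a b → P a b' → (b' : ℕ) < b + 3) :
    {c : Fin N × Fin N | P c.1 c.2}.ncard ≤ 3 * N := by
  have hinj : Set.InjOn (fun c : Fin N × Fin N => (c.1, Fin.ofNat 3 c.2))
      {c | P c.1 c.2} := by
    rintro ⟨a, b⟩ h ⟨a', b'⟩ h' e
    simp only [Prod.mk.injEq, Fin.ofNat, Fin.mk.injEq] at e
    obtain ⟨rfl, e⟩ := e
    have h₁ := hP _ _ _ h h'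
    have h₂ := hP _ _ _ h' h
    exact Prod.ext rfl (Fin.ext (by simp only at h₁ h₂ ⊢; omega))
  calc {c : Fin N × Fin N | P c.1 c.2}.ncard
      ≤ (Set.univ : Set (Fin N × Fin 3)).ncard :=
        Set.ncard_le_ncard_of_injOn _ (fun _ _ => Set.mem_univ _) hinj
    _ = 3 * N := by simp [mul_comm]

theorem CutsVertically.mem_iUnion_disc_of_far {a b b' : Fin N} (hσ : |σ| = 1) (hε : 0 < ε)
    (hεr : 100 * ε ≤ r) (hN : N * ε ≤ 2 * r / 5)
    (h : CutsVertically r σ C (gridCell o ε (a, b))) (hq' : q' ∈ gridCell o ε (a, b'))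
    (hfar : ∀ p ∈ gridCell o ε (a, b), 2 * ε ≤ σ * (q'.2 - p.2)) :
    q' ∈ ⋃ w ∈ C, disc r w := by
  obtain ⟨⟨w, hw, p, hp, hpw, hdir⟩, q, hq, hqU⟩ := h
  have hqw : q ∉ disc r w := fun hqw => hqU (Set.mem_biUnion hw hqw)
  obtain ⟨hp₁, hp₂⟩ := gridStrip_subset_Ico _ hε.le _ hp.2
  obtain ⟨hq'₁, hq'₂⟩ := gridStrip_subset_Ico _ hε.le _ hq'.2
  have hle : σ * (q'.2 - p.2) ≤ 2 * r / 5 := calc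
    σ * (q'.2 - p.2) ≤ |q'.2 - p.2| := by
      simpa [abs_mul, hσ] using le_abs_self (σ * (q'.2 - p.2))
    _ ≤ N * ε := abs_le.2 ⟨by linarith, by linarith⟩
    _ ≤ 2 * r / 5 := hN
  exact Set.mem_biUnion hw (mem_disc_of_far hσ hε hεr hpw hqw hdir
    (abs_sub_le_of_mem_gridStrip hq.1 hp.1) (abs_sub_le_of_mem_gridStrip hq.2 hp.2)
    (abs_sub_le_of_mem_gridStrip hq'.1 hp.1) (hfar p hp) hle)

theorem ncard_cutsVertically_le (o : ℝ × ℝ) (C : Set (ℝ × ℝ)) (hσ : |σ| = 1) (hε : 0 < ε)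
    (hεr : 100 * ε ≤ r) (hN : N * ε ≤ 2 * r / 5) :
    {c : Fin N × Fin N | CutsVertically r σ C (gridCell o ε c)}.ncard ≤ 3 * N := by
  refine ncard_le_of_column_bound (P := fun a b => CutsVertically r σ C (gridCell o ε (a, b))) ?_
  intro a b b' h h'
  by_contra! hlt
  rcases eq_or_eq_neg_of_abs_eq hσ with rfl | rfl
  · obtain ⟨q', hq', hq'U⟩ := h'.2
    refine hq'U (h.mem_iUnion_disc_of_far hσ hε hεr hN hq' fun p hp => ?_)
    simpa using two_mul_le_sub_of_mem_gridStrip hε.le hlt hp.2 hq'.2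
  · obtain ⟨q', hq', hq'U⟩ := h.2
    refine hq'U (h'.mem_iUnion_disc_of_far hσ hε hεr hN hq' fun p hp => ?_)
    simpa using two_mul_le_sub_of_mem_gridStrip hε.le hlt hq'.2 hp.2

theorem ncard_cuts_iUnion_disc_le (o : ℝ × ℝ) (C : Set (ℝ × ℝ)) (hε : 0 < ε)
    (hεr : 100 * ε ≤ r) (hN : N * ε ≤ 2 * r / 5) :
    {c : Fin N × Fin N | Cuts (⋃ w ∈ C, disc r w) (gridCell o ε c)}.ncard ≤ 12 * N := by
  let A (σ : ℝ) (o : ℝ × ℝ) (C : Set (ℝ × ℝ)) : Set (Fin N × Fin N) :=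
    {c | CutsVertically r σ C (gridCell o ε c)}
  let D (σ : ℝ) : Set (Fin N × Fin N) := A σ o C ∪ Prod.swap ⁻¹' A σ o.swap (Prod.swap ⁻¹' C)
  have hswap : ∀ c : Fin N × Fin N, Prod.swap ⁻¹' gridCell o ε c = gridCell o.swap ε c.swap :=
    fun c => Set.preimage_swap_prod _ _
  have hsub : {c : Fin N × Fin N | Cuts (⋃ w ∈ C, disc r w) (gridCell o ε c)} ⊆ D 1 ∪ D (-1) := by
    intro c hc
    obtain ⟨σ, hσ, h⟩ := hc.exists_cutsVertically
    rw [hswap] at h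
    rcases hσ with rfl | rfl
    · exact Or.inl h
    · exact Or.inr h
  have hD : ∀ σ : ℝ, |σ| = 1 → (D σ).ncard ≤ 3 * N + 3 * N := fun σ hσ => calc
    (D σ).ncard ≤ (A σ o C).ncard + (A σ o.swap (Prod.swap ⁻¹' C)).ncard := by
      refine (Set.ncard_union_le _ _).trans (add_le_add_right ?_ _)
      exact (Set.ncard_preimage_of_injective_subset_range Prod.swap_injective
        (by simp [Prod.swap_surjective.range_eq])).le
    _ ≤ 3 * N + 3 * N := add_le_add (ncard_cutsVertically_le _ _ hσ hε hεr hN)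
      (ncard_cutsVertically_le _ _ hσ hε hεr hN)
  calc _ ≤ (D 1 ∪ D (-1)).ncard := Set.ncard_le_ncard hsub
    _ ≤ (D 1).ncard + (D (-1)).ncard := Set.ncard_union_le _ _
    _ ≤ (3 * N + 3 * N) + (3 * N + 3 * N) := add_le_add (hD 1 abs_one) (hD (-1) (by simp))
    _ = 12 * N := by ring

end Geometry

section Torus

variable {L δ r : ℝ}

theorem exists_coe_eq_and_norm_coe_sub_eq_abs (L x c : ℝ) :
    ∃ x' : ℝ, (x' : AddCircle L) = x ∧ ‖((x - c : ℝ) : AddCircle L)‖ = |x' - c| := by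
  refine ⟨x - round (L⁻¹ * (x - c)) * L, ?_, ?_⟩
  · rw [← zsmul_eq_mul, AddCircle.coe_sub, AddCircle.coe_zsmul, AddCircle.coe_period, smul_zero,
      sub_zero]
  · rw [AddCircle.norm_eq, sub_right_comm]

theorem exists_norm_coe_sub_eq_abs (hL : 0 < L) (hδ : 0 ≤ δ) (h : r + 2 * δ < L / 2) (x c : ℝ) :
    ∃ x' : ℝ, ∀ t, |t - c| ≤ δ → ‖((x - t : ℝ) : AddCircle L)‖ = |x' - t| ∨
      (r < ‖((x - t : ℝ) : AddCircle L)‖ ∧ r < |x' - t|) := by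
  obtain ⟨x', hx', hnorm⟩ := exists_coe_eq_and_norm_coe_sub_eq_abs L x c
  rw [AddCircle.coe_sub, ← hx'] at hnorm
  refine ⟨x', fun t ht => ?_⟩
  rw [AddCircle.coe_sub, ← hx']
  rcases le_or_gt |x' - t| (L / 2) with hle | hlt
  · left
    rw [← AddCircle.coe_sub]
    exact (AddCircle.norm_coe_eq_abs_iff L hL.ne').2 (by rwa [abs_of_pos hL])
  · right
    refine ⟨?_, by linarith⟩
    have htc : ‖(t - c : AddCircle L)‖ ≤ δ := by
      rw [← AddCircle.coe_sub]
      exact (QuotientAddGroup.norm_mk_le_norm).trans ht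
    have htri : |x' - c| ≤ ‖(x' - t : AddCircle L)‖ + ‖(t - c : AddCircle L)‖ :=
      hnorm ▸ norm_sub_le_norm_sub_add_norm_sub _ _ _
    have habs : |x' - t| ≤ |x' - c| + |t - c| := by
      rw [abs_sub_comm t c]
      exact abs_sub_le _ _ _
    linarith

theorem exists_torusDist_le_iff_mem_disc (hr : 0 ≤ r) (hL : 0 < L) (hδ : 0 ≤ δ)
    (h : r + 2 * δ < L / 2) (c w : ℝ × ℝ) :
    ∃ w' : ℝ × ℝ, ∀ p : ℝ × ℝ, |p.1 - c.1| ≤ δ → |p.2 - c.2| ≤ δ →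
      (torusDist L w p ≤ r ↔ p ∈ disc r w') := by
  obtain ⟨x, hx⟩ := exists_norm_coe_sub_eq_abs hL hδ h w.1 c.1
  obtain ⟨y, hy⟩ := exists_norm_coe_sub_eq_abs hL hδ h w.2 c.2
  refine ⟨(x, y), fun p hp₁ hp₂ => ?_⟩
  rw [torusDist, Real.sqrt_le_left hr, disc, Set.mem_ofPred_eq, ← sq_abs (x - p.1),
    ← sq_abs (y - p.2)]
  have hfst : ∀ a b : ℝ, r < a → ¬ a ^ 2 + b ^ 2 ≤ r ^ 2 := fun a b ha => by
    nlinarith [sq_nonneg b]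
  have hsnd : ∀ a b : ℝ, r < b → ¬ a ^ 2 + b ^ 2 ≤ r ^ 2 := fun a b hb => by
    nlinarith [sq_nonneg a]
  rcases hx p.1 hp₁ with hx | ⟨hx, hx'⟩
  · rcases hy p.2 hp₂ with hy | ⟨hy, hy'⟩
    · rw [hx, hy]
    · exact iff_of_false (hsnd _ _ hy) (hsnd _ _ hy')
  · exact iff_of_false (hfst _ _ hx) (hfst _ _ hx')

theorem exists_torusDist_le_iff_mem_iUnion_disc (hr : 0 ≤ r) (hL : 0 < L) (hδ : 0 ≤ δ)
    (h : r + 2 * δ < L / 2) (c : ℝ × ℝ) (C : Set (ℝ × ℝ)) :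
    ∃ C' : Set (ℝ × ℝ), ∀ p : ℝ × ℝ, |p.1 - c.1| ≤ δ → |p.2 - c.2| ≤ δ →
      ((∃ w ∈ C, torusDist L w p ≤ r) ↔ p ∈ ⋃ w ∈ C', disc r w) := by
  choose f hf using exists_torusDist_le_iff_mem_disc hr hL hδ h c
  refine ⟨f '' C, fun p hp₁ hp₂ => ?_⟩
  simp only [Set.biUnion_image, Set.mem_iUnion, exists_prop, ← hf _ p hp₁ hp₂]

end Torus

section Collisions

variable {α β ι ι' : Type*}

/-- The configurations `W` of points in which no point lies in a cell `Q c` with `c ∈ Occ`, and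
each cell `Q c` with `c ∈ Good` contains at most one point. -/
def collisionFree (ι : Type*) (Q : β → Set α) (Good Occ : Set β) : Set (ι → α) :=
  {W | (∀ c ∈ Occ, ∀ i, W i ∉ Q c) ∧ ∀ c ∈ Good, {i | W i ∈ Q c}.Subsingleton}

variable [MeasurableSpace α]

theorem collisionFree_succ_subset (Q : β → Set α) (Good Occ : Set β) (j : ℕ) :
    collisionFree (Fin (j + 1)) Q Good Occ ⊆
      MeasurableEquiv.piFinSuccAbove (fun _ : Fin (j + 1) => α) 0 ⁻¹'
        ((⋃ c ∈ Good, Q c)ᶜ ×ˢ collisionFree (Fin j) Q Good Occ ∪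
          ⋃ c ∈ Good \ Occ, Q c ×ˢ collisionFree (Fin j) Q Good (insert c Occ)) := by
  rintro W ⟨hOcc, hGood⟩
  have hsucc : ∀ c ∈ Good, {i : Fin j | W i.succ ∈ Q c}.Subsingleton := fun c hc i hi k hk =>
    Fin.succ_injective _ (hGood c hc hi hk)
  by_cases h₀ : ∃ c ∈ Good, W 0 ∈ Q c
  · obtain ⟨c, hc, h₀⟩ := h₀
    refine Or.inr (Set.mem_biUnion (x := c) ⟨hc, fun hcO => hOcc c hcO 0 h₀⟩
      ⟨h₀, fun d hd i => ?_, hsucc⟩)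
    rcases hd with rfl | hd
    · exact fun hi => Fin.succ_ne_zero i (hGood d hc hi h₀)
    · exact hOcc d hd i.succ
  · refine Or.inl ⟨?_, fun c hc i => hOcc c hc i.succ, hsucc⟩
    simpa using h₀

theorem measureReal_collisionFree_succ_le (ω : Measure α) [IsProbabilityMeasure ω] {Q : β → Set α}
    {Good Occ : Finset β} (hQ : (Good : Set β).PairwiseDisjoint Q)
    (hQm : ∀ c ∈ Good, MeasurableSet (Q c)) {q : ℝ} (hq : ∀ c ∈ Good, ω.real (Q c) = q)
    (hO : Occ ⊆ Good) {j : ℕ} {b b' : ℝ}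
    (hb : (Measure.pi fun _ : Fin j => ω).real (collisionFree (Fin j) Q Good Occ) ≤ b)
    (hb' : ∀ c ∈ Good, c ∉ Occ → (Measure.pi fun _ : Fin j => ω).real
      (collisionFree (Fin j) Q Good (insert c (Occ : Set β))) ≤ b') :
    (Measure.pi fun _ : Fin (j + 1) => ω).real (collisionFree (Fin (j + 1)) Q Good Occ) ≤
      (1 - q * Good.card) * b + (Good.card - Occ.card) * (q * b') := by
  classical
  let π (k : ℕ) := Measure.pi fun _ : Fin k => ω
  have hmiss : ω.real (⋃ c ∈ Good, Q c)ᶜ = 1 - q * Good.card := by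
    rw [probReal_compl_eq_one_sub (Good.measurableSet_biUnion hQm),
      measureReal_biUnion_finset hQ hQm, Finset.sum_congr rfl hq, Finset.sum_const, nsmul_eq_mul,
      mul_comm]
  have hfst : (ω.prod (π j)).real ((⋃ c ∈ Good, Q c)ᶜ ×ˢ collisionFree (Fin j) Q Good Occ) ≤
      (1 - q * Good.card) * b := by
    rw [measureReal_prod_prod, hmiss]
    exact mul_le_mul_of_nonneg_left hb (hmiss ▸ measureReal_nonneg)
  have hsnd : (ω.prod (π j)).real (⋃ c ∈ Good \ Occ,
      Q c ×ˢ collisionFree (Fin j) Q Good (insert c (Occ : Set β))) ≤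
      (Good.card - Occ.card) * (q * b') := calc
    _ ≤ ∑ c ∈ Good \ Occ, (ω.prod (π j)).real
        (Q c ×ˢ collisionFree (Fin j) Q Good (insert c (Occ : Set β))) :=
      measureReal_biUnion_finset_le _ _
    _ ≤ ∑ _c ∈ Good \ Occ, q * b' := by
      refine Finset.sum_le_sum fun c hc => ?_
      obtain ⟨hcG, hcO⟩ := Finset.mem_sdiff.1 hc
      rw [measureReal_prod_prod, hq c hcG]
      exact mul_le_mul_of_nonneg_left (hb' c hcG hcO) (hq c hcG ▸ measureReal_nonneg)
    _ = (Good.card - Occ.card) * (q * b') := by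
      rw [Finset.sum_const, nsmul_eq_mul, Finset.cast_card_sdiff hO]
  have hsub := collisionFree_succ_subset Q (Good : Set β) (Occ : Set β) j
  simp only [← Finset.coe_sdiff, Finset.mem_coe] at hsub
  have hπ := measurePreserving_piFinSuccAbove (fun _ : Fin (j + 1) => ω) 0
  calc _ ≤ _ := measureReal_mono hsub
    _ = _ := by rw [measureReal_def, hπ.measure_preimage_equiv, ← measureReal_def]
    _ ≤ _ := measureReal_union_le _ _
    _ ≤ _ := add_le_add hfst hsnd

theorem exp_neg_le_one_sub_half {x : ℝ} (hx₀ : 0 ≤ x) (hx₁ : x ≤ 1) :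
    Real.exp (-x) ≤ 1 - x / 2 := by
  rw [Real.exp_neg, inv_le_comm₀ (Real.exp_pos _) (by linarith),
    inv_le_iff_one_le_mul₀ (by linarith)]
  nlinarith [Real.add_one_le_exp x]

/-- A bound for the probability that `j` further points do not collide when `a` cells are
occupied and each cell has probability `q`. The constants are what the induction over `j` in
`measureReal_collisionFree_fin_le` yields if the good cells have total probability at least `1 / 2`
and `q * j ≤ 2`. -/
def collisionBound (q : ℝ) (j a : ℕ) : ℝ :=
  Real.exp (-(q * ((j : ℝ) * a / 2 + (j : ℝ) * (j - 1) / 16)))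

theorem collisionBound_succ_left (q : ℝ) (j a : ℕ) :
    collisionBound q (j + 1) a = collisionBound q j a * Real.exp (-(q * (a / 2 + j / 8))) := by
  rw [collisionBound, collisionBound, ← Real.exp_add]
  congr 1
  push_cast
  ring

theorem collisionBound_succ_right (q : ℝ) (j a : ℕ) :
    collisionBound q j (a + 1) = collisionBound q j a * Real.exp (-(q * j / 2)) := by
  rw [collisionBound, collisionBound, ← Real.exp_add]
  congr 1
  push_cast
  ring

theorem collisionBound_recursion {q g : ℝ} {j a : ℕ} (hq : 0 ≤ q) (hg : 1 / 2 ≤ q * g)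
    (ha : a ≤ g) (hj : q * j ≤ 2) :
    (1 - q * g) * collisionBound q j a + (g - a) * (q * collisionBound q j (a + 1)) ≤
      collisionBound q (j + 1) a := by
  rw [collisionBound_succ_right, collisionBound_succ_left]
  have hexp : Real.exp (-(q * j / 2)) ≤ 1 - q * j / 4 :=
    (exp_neg_le_one_sub_half (by positivity) (by linarith)).trans_eq (by ring)
  have key : 1 - q * g + q * (g - a) * Real.exp (-(q * j / 2)) ≤
      Real.exp (-(q * (a / 2 + j / 8))) := calc
    _ ≤ 1 - q * g + q * (g - a) * (1 - q * j / 4) := by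
      have := sub_nonneg.2 ha
      gcongr
    _ ≤ 1 - q * (a / 2 + j / 8) := by
      have h₁ : q * a * (q * j) ≤ q * a * 2 := by gcongr
      have h₂ : 1 / 2 * (q * j) ≤ q * g * (q * j) := by gcongr
      linarith
    _ ≤ Real.exp (-(q * (a / 2 + j / 8))) := Real.one_sub_le_exp_neg _
  calc _ = collisionBound q j a * (1 - q * g + q * (g - a) * Real.exp (-(q * j / 2))) := by ring
    _ ≤ _ := mul_le_mul_of_nonneg_left key (Real.exp_pos _).le

theorem measureReal_collisionFree_fin_le (ω : Measure α) [IsProbabilityMeasure ω] {Q : β → Set α}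
    {Good : Finset β} (hQ : (Good : Set β).PairwiseDisjoint Q)
    (hQm : ∀ c ∈ Good, MeasurableSet (Q c)) {q : ℝ} (hq : ∀ c ∈ Good, ω.real (Q c) = q)
    (hG : 1 / 2 ≤ q * Good.card) {j : ℕ} (hj : q * j ≤ 2) {Occ : Finset β} (hO : Occ ⊆ Good) :
    (Measure.pi fun _ : Fin j => ω).real (collisionFree (Fin j) Q Good Occ) ≤
      collisionBound q j Occ.card := by
  classical
  have hq₀ : 0 ≤ q := by
    by_contra! h
    nlinarith [Good.card.cast_nonneg (α := ℝ)]
  induction j generalizing Occ with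
  | zero => simp [collisionBound]
  | succ j ih =>
    have hj' : q * j ≤ 2 := by
      push_cast at hj
      linarith
    have hstep := measureReal_collisionFree_succ_le ω hQ hQm hq hO (ih hj' hO)
      (b' := collisionBound q j (Occ.card + 1)) fun c hc hcO => by
        have := ih hj' (Finset.insert_subset hc hO)
        rwa [Finset.card_insert_of_notMem hcO, Finset.coe_insert] at this
    exact hstep.trans
      (collisionBound_recursion hq₀ hG (by exact_mod_cast Finset.card_le_card hO) hj')

theorem measurePreserving_comp_injective [Fintype ι] [Fintype ι'] (ω : Measure α)
    [IsProbabilityMeasure ω] {e : ι' → ι} (he : Function.Injective e) :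
    MeasurePreserving (fun (W : ι → α) k => W (e k)) (Measure.pi fun _ => ω)
      (Measure.pi fun _ => ω) where
  measurable := by fun_prop
  map_eq := by
    have h : iIndepFun (fun (i : ι) (W : ι → α) => W i) (Measure.pi fun _ : ι => ω) :=
      iIndepFun_pi (X := fun _ => id) fun _ => aemeasurable_id
    rw [(iIndepFun_iff_map_fun_eq_pi_map fun _ => (measurable_pi_apply _).aemeasurable).1
      (h.precomp he)]
    congr with k : 1
    exact (measurePreserving_eval (fun _ : ι => ω) (e k)).map_eq

theorem measureReal_collisionFree_le [Fintype ι] (ω : Measure α) [IsProbabilityMeasure ω]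
    {Q : β → Set α} {Good : Finset β} (hQ : (Good : Set β).PairwiseDisjoint Q)
    (hQm : ∀ c ∈ Good, MeasurableSet (Q c)) {q : ℝ} (hq : ∀ c ∈ Good, ω.real (Q c) = q)
    (hG : 1 / 2 ≤ q * Good.card) {M : ℕ} (hM : q * M ≤ 2) {J : Finset ι} (hJ : M ≤ J.card) :
    (Measure.pi fun _ : ι => ω).real {W | ∀ c ∈ Good, {i ∈ (J : Set ι) | W i ∈ Q c}.Subsingleton} ≤
      Real.exp (-(q * (M * (M - 1)) / 16)) := by
  obtain ⟨e⟩ : Nonempty (Fin M ↪ J) :=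
    Function.Embedding.nonempty_of_card_le (by simpa using hJ)
  have he : Function.Injective fun k => (e k : ι) := Subtype.val_injective.comp e.injective
  calc (Measure.pi fun _ : ι => ω).real
        {W | ∀ c ∈ Good, {i ∈ (J : Set ι) | W i ∈ Q c}.Subsingleton}
      ≤ (Measure.pi fun _ : ι => ω).real
          ((fun W k => W (e k)) ⁻¹' collisionFree (Fin M) Q Good ∅) :=
        measureReal_mono fun W hW => ⟨by simp, fun c hc i hi k hk =>
          he (hW c hc ⟨(e i).2, hi⟩ ⟨(e k).2, hk⟩)⟩
    _ ≤ (Measure.pi fun _ : Fin M => ω).real (collisionFree (Fin M) Q Good ∅) := by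
        rw [measureReal_def, measureReal_def]
        exact ENNReal.toReal_mono (by finiteness)
          ((measurePreserving_comp_injective ω he).measure_preimage_le _)
    _ ≤ collisionBound q M 0 := by
        simpa using measureReal_collisionFree_fin_le ω hQ hQm hq hG hM (Occ := ∅) (by simp)
    _ = Real.exp (-(q * (M * (M - 1)) / 16)) := by
        rw [collisionBound]
        congr 1
        push_cast
        ring

end Collisions

section Resampling

variable {α ι : Type*}

open Classical in
/-- The points of the configuration `x` that are in `B` are replaced by those of `w`. -/
def resample (B : Set α) (x w : ι → α) : ι → α :=
  (x ⁻¹' B).piecewise w x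

theorem resample_of_mem {B : Set α} {x : ι → α} (w : ι → α) {i : ι} (hi : x i ∈ B) :
    resample B x w i = w i := by
  classical
  exact Set.piecewise_eq_of_mem _ _ _ hi

theorem resample_of_notMem {B : Set α} {x : ι → α} (w : ι → α) {i : ι} (hi : x i ∉ B) :
    resample B x w i = x i := by
  classical
  exact Set.piecewise_eq_of_notMem _ _ _ hi

variable [MeasurableSpace α] {B : Set α}

open Classical in
theorem measurePreserving_ite_prod_cond (ν : Measure α) [IsFiniteMeasure ν]
    (hB : MeasurableSet B) (hB₀ : ν B ≠ 0) :
    MeasurePreserving (fun z : α × α => if z.1 ∈ B then z.2 else z.1) (ν.prod ν[|B]) ν := by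
  have := cond_isProbabilityMeasure hB₀
  have hmeas : Measurable fun z : α × α => if z.1 ∈ B then z.2 else z.1 :=
    Measurable.ite (measurable_fst hB) measurable_snd measurable_fst
  refine ⟨hmeas, ?_⟩
  ext E hE
  have hpre : (fun z : α × α => if z.1 ∈ B then z.2 else z.1) ⁻¹' E =
      B ×ˢ E ∪ (E \ B) ×ˢ Set.univ := by
    ext z
    by_cases hz : z.1 ∈ B <;> simp [hz]
  have hdisj : Disjoint (B ×ˢ E) ((E \ B) ×ˢ (Set.univ : Set α)) :=
    Set.disjoint_prod.2 (Or.inl Set.disjoint_sdiff_right)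
  rw [Measure.map_apply hmeas hE, hpre,
    measure_union hdisj ((hE.diff hB).prod MeasurableSet.univ), Measure.prod_prod,
    Measure.prod_prod, measure_univ, mul_one, mul_comm, cond_mul_eq_inter hB, Set.inter_comm,
    measure_inter_add_sdiff E hB]

variable [Fintype ι]

theorem measurePreserving_resample (ν : Measure α) [IsFiniteMeasure ν]
    (hB : MeasurableSet B) (hB₀ : ν B ≠ 0) :
    MeasurePreserving (fun z : (ι → α) × (ι → α) => resample B z.1 z.2)
      ((Measure.pi fun _ => ν).prod (Measure.pi fun _ => ν[|B])) (Measure.pi fun _ => ν) := by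
  have := cond_isProbabilityMeasure hB₀
  have hpairs := measurePreserving_arrowProdEquivProdArrow α α ι (fun _ => ν) (fun _ => ν[|B])
  exact (measurePreserving_pi _ _ fun _ : ι => measurePreserving_ite_prod_cond ν hB hB₀).comp
    hpairs.symm

/-- To bound the probability of an event, one may condition on the points outside of `B` and on
the indices of the points in `B`. -/
theorem measure_le_of_resample_le (ν : Measure α) [IsProbabilityMeasure ν] (hB : MeasurableSet B)
    (hB₀ : ν B ≠ 0) {E : Set (ι → α)} (hE : MeasurableSet E) {δ : ENNReal}
    (h : ∀ x, (Measure.pi fun _ : ι => ν[|B]) {w | resample B x w ∈ E} ≤ δ) :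
    (Measure.pi fun _ : ι => ν) E ≤ δ := by
  have := cond_isProbabilityMeasure hB₀
  have hres := measurePreserving_resample (ι := ι) ν hB hB₀
  rw [← hres.measure_preimage hE.nullMeasurableSet, Measure.prod_apply (hres.measurable hE)]
  calc _ ≤ ∫⁻ _, δ ∂(Measure.pi fun _ : ι => ν) := lintegral_mono h
    _ = δ := by simp

end Resampling

section Count

variable {α ι : Type*}

theorem sum_indicator_one_eq_ncard [Fintype ι] (B : Set α) (x : ι → α) :
    ∑ i, B.indicator (1 : α → ℝ) (x i) = {i | x i ∈ B}.ncard := by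
  classical
  simp [Set.indicator_apply, Set.ncard_eq_toFinset_card']

variable [MeasurableSpace α] {B : Set α}

theorem mgf_indicator_one_neg_log_two (ν : Measure α) [IsProbabilityMeasure ν]
    (hB : MeasurableSet B) :
    mgf (B.indicator 1) ν (-Real.log 2) = 1 - ν.real B / 2 := by
  have hexp : ∀ a, Real.exp (-Real.log 2 * B.indicator 1 a) =
      1 - B.indicator (fun _ => (1 / 2 : ℝ)) a := fun a => by
    by_cases ha : a ∈ B
    · rw [Set.indicator_of_mem ha, Set.indicator_of_mem ha, Pi.one_apply, mul_one, Real.exp_neg,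
        Real.exp_log two_pos]
      norm_num
    · simp [ha]
  simp_rw [mgf, hexp]
  rw [integral_sub (integrable_const _) ((integrable_const _).indicator hB),
    integral_indicator_const _ hB, integral_const, probReal_univ, smul_eq_mul, smul_eq_mul]
  ring

/-- Markov's inequality for the exponential moment of the count with base `1 / 2`. -/
theorem measureReal_ncard_lt_le [Fintype ι] (ν : Measure α) [IsProbabilityMeasure ν]
    (hB : MeasurableSet B) (T : ℝ) :
    (Measure.pi fun _ : ι => ν).real {x | ({i | x i ∈ B}.ncard : ℝ) < T} ≤
      Real.exp (T * Real.log 2 - Fintype.card ι * ν.real B / 2) := by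
  let X (i : ι) (x : ι → α) : ℝ := B.indicator 1 (x i)
  let μ := Measure.pi fun _ : ι => ν
  have hind : Measurable (B.indicator (1 : α → ℝ)) := measurable_one.indicator hB
  have hX : ∀ i, Measurable (X i) := fun i => hind.comp (measurable_pi_apply i)
  have hindep : iIndepFun X μ :=
    iIndepFun_pi (X := fun _ => B.indicator 1) fun _ => hind.aemeasurable
  have hint : ∀ i, Integrable (fun x => Real.exp (-Real.log 2 * X i x)) μ := fun i =>
    integrable_exp_mul_of_mem_Icc (hX i).aemeasurable (ae_of_all _ fun x =>
      ⟨Set.indicator_nonneg (by simp) _, Set.indicator_le_self' (by simp) _⟩)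
  have hmgf : ∀ i, mgf (X i) μ (-Real.log 2) = 1 - ν.real B / 2 := fun i => by
    have heval := measurePreserving_eval (fun _ : ι => ν) i
    have hexp : Measurable fun a => Real.exp (-Real.log 2 * B.indicator 1 a) :=
      (hind.const_mul _).exp
    rw [← mgf_indicator_one_neg_log_two ν hB]
    conv_rhs => rw [← heval.map_eq]
    exact (mgf_map heval.aemeasurable hexp.aestronglyMeasurable).symm
  calc μ.real {x | ({i | x i ∈ B}.ncard : ℝ) < T}
      ≤ μ.real {x | (∑ i, X i) x ≤ T} := measureReal_mono fun x (hx : _ < T) => by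
        rw [Set.mem_ofPred_eq, Finset.sum_apply, sum_indicator_one_eq_ncard]
        exact hx.le
    _ ≤ Real.exp (- -Real.log 2 * T) * mgf (∑ i, X i) μ (-Real.log 2) :=
        measure_le_le_exp_mul_mgf T (by simp [Real.log_nonneg])
          (hindep.integrable_exp_mul_sum hX fun i _ => hint i)
    _ = Real.exp (T * Real.log 2) * (1 - ν.real B / 2) ^ Fintype.card ι := by
        rw [hindep.mgf_sum hX, Finset.prod_congr rfl fun i _ => hmgf i, Finset.prod_const,
          Finset.card_univ, neg_neg, mul_comm T]
    _ ≤ Real.exp (T * Real.log 2) * Real.exp (-(ν.real B / 2)) ^ Fintype.card ι := by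
        have hB₁ : ν.real B ≤ 1 := measureReal_le_one
        gcongr
        · linarith
        · exact Real.one_sub_le_exp_neg _
    _ = Real.exp (T * Real.log 2 - Fintype.card ι * ν.real B / 2) := by
        rw [← Real.exp_nat_mul, ← Real.exp_add]
        congr 1
        ring

end Count

section Core

variable {n N m : ℕ} {L r : ℝ}

/-- A square of side `2r/5` in the middle of `[0, L]²`. It lies in the disc of radius `r/3` about
the centre, and any two of its points are within distance `r`. -/
def core (L r : ℝ) : Set (ℝ × ℝ) :=
  Set.Ico (L / 2 - r / 5) (L / 2 + r / 5) ×ˢ Set.Ico (L / 2 - r / 5) (L / 2 + r / 5)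

/-- The cells of the subdivision of the core into `N × N` squares. -/
def coreCell (L r : ℝ) (c : Fin N × Fin N) : Set (ℝ × ℝ) :=
  gridCell (L / 2 - r / 5, L / 2 - r / 5) (2 * r / 5 / N) c

/-- The vertices of the random geometric graph whose position is in the core. -/
def coreVertices (L r : ℝ) (x : Fin n → ℝ × ℝ) : Set (Fin n) :=
  x ⁻¹' core L r

theorem measurableSet_core (L r : ℝ) : MeasurableSet (core L r) :=
  measurableSet_Ico.prod measurableSet_Ico

theorem coreCell_subset_core (hr : 0 ≤ r) (c : Fin N × Fin N) : coreCell L r c ⊆ core L r := by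
  have hN : (N : ℝ) ≠ 0 := by exact_mod_cast c.1.pos.ne'
  have hend : L / 2 - r / 5 + N * (2 * r / 5 / N) = L / 2 + r / 5 := by
    field_simp
    ring
  have hsub := gridCell_subset_prod_Ico (L / 2 - r / 5, L / 2 - r / 5)
    (ε := 2 * r / 5 / N) (by positivity) c
  rwa [hend] at hsub

theorem abs_sub_half_le_of_mem_Ico {a t : ℝ} (ht : t ∈ Set.Ico (L / 2 - a) (L / 2 + a)) :
    |t - L / 2| ≤ a :=
  abs_le.2 ⟨by linarith [ht.1], by linarith [ht.2]⟩

theorem torusDist_le_of_abs_le {a : ℝ} {p q : ℝ × ℝ} (hL : 0 < L) (ha : 2 * a ≤ L) (hr : 0 ≤ r)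
    (har : 2 * a ^ 2 ≤ r ^ 2) (h₁ : |p.1 - q.1| ≤ a) (h₂ : |p.2 - q.2| ≤ a) :
    torusDist L p q ≤ r := by
  have hnorm : ∀ t : ℝ, |t| ≤ a → ‖(t : AddCircle L)‖ = |t| := fun t ht =>
    (AddCircle.norm_coe_eq_abs_iff L hL.ne').2 (by rw [abs_of_pos hL]; linarith)
  rw [torusDist, Real.sqrt_le_left hr, hnorm _ h₁, hnorm _ h₂]
  nlinarith [abs_nonneg (p.1 - q.1), abs_nonneg (p.2 - q.2)]

theorem isClique_coreVertices (hr : 0 < r) (hL : 4 * r < L) (x : Fin n → ℝ × ℝ) :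
    (torusGraph L r x).IsClique (coreVertices L r x) := by
  have hside : ∀ s t, s ∈ Set.Ico (L / 2 - r / 5) (L / 2 + r / 5) →
      t ∈ Set.Ico (L / 2 - r / 5) (L / 2 + r / 5) → |s - t| ≤ 2 * r / 5 := fun s t hs ht =>
    abs_le.2 ⟨by linarith [hs.1, ht.2], by linarith [hs.2, ht.1]⟩
  intro u hu v hv huv
  exact ⟨huv, torusDist_le_of_abs_le (a := 2 * r / 5) (by linarith) (by linarith) hr.le
    (by nlinarith) (hside _ _ hu.1 hv.1) (hside _ _ hu.2 hv.2)⟩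

theorem coreVertices_subset_centralBall (hr : 0 < r) (hL : 4 * r < Real.sqrt n)
    (x : Fin n → ℝ × ℝ) : coreVertices (Real.sqrt n) r x ⊆ centralBall (r / 3) x := fun _ hi =>
  torusDist_le_of_abs_le (a := r / 5) (by linarith) (by linarith) (by linarith) (by nlinarith)
    (abs_sub_half_le_of_mem_Ico hi.1) (abs_sub_half_le_of_mem_Ico hi.2)

/-- The points of the torus within distance `r` of the vertices that are reached from `s` in fewer
than `k` steps outside the core. A core vertex `i` is adjacent to one of these vertices if and
only if its position is in this region. -/
def region (L r : ℝ) (x : Fin n → ℝ × ℝ) (s : Fin n) (k : ℕ) : Set (ℝ × ℝ) :=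
  {p | ∃ w ∈ x '' outerBall (torusGraph L r x) (coreVertices L r x) s k, torusDist L w p ≤ r}

theorem ncard_cuts_region_le (hr : 0 < r) (hL : 4 * r < L) (hN : 40 ≤ N) (x : Fin n → ℝ × ℝ)
    (s : Fin n) (k : ℕ) :
    {c : Fin N × Fin N | Cuts (region L r x s k) (coreCell L r c)}.ncard ≤ 12 * N := by
  obtain ⟨C, hC⟩ := exists_torusDist_le_iff_mem_iUnion_disc hr.le (L := L) (δ := r / 5)
    (by linarith) (by linarith) (by linarith) (L / 2, L / 2)
    (x '' outerBall (torusGraph L r x) (coreVertices L r x) s k)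
  have hN₀ : (40 : ℝ) ≤ N := by exact_mod_cast hN
  have hcuts : ∀ c : Fin N × Fin N, Cuts (region L r x s k) (coreCell L r c) →
      Cuts (⋃ w ∈ C, disc r w) (coreCell L r c) := by
    have hmem : ∀ c : Fin N × Fin N, ∀ p ∈ coreCell L r c,
        (p ∈ region L r x s k ↔ p ∈ ⋃ w ∈ C, disc r w) := fun c p hp =>
      have hp := coreCell_subset_core hr.le c hp
      hC p (abs_sub_half_le_of_mem_Ico hp.1) (abs_sub_half_le_of_mem_Ico hp.2)
    rintro c ⟨⟨p, hp, hpU⟩, q, hq, hqU⟩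
    exact ⟨⟨p, hp, (hmem c p hp).1 hpU⟩, q, hq, mt (hmem c q hq).2 hqU⟩
  refine (Set.ncard_le_ncard hcuts (Set.toFinite _)).trans
    (ncard_cuts_iUnion_disc_le _ C (by positivity) ?_ ?_)
  · rw [← mul_div_assoc, div_le_iff₀ (by linarith)]
    nlinarith
  · rw [mul_div_cancel₀ _ (by linarith)]

/-- The cells that are cut by none of the regions given by `t`. -/
def goodCells (L r : ℝ) (N : ℕ) (x : Fin n → ℝ × ℝ) (t : Fin m → Fin n × Fin n) :
    Set (Fin N × Fin N) :=
  {c | ∀ l, ¬ Cuts (region L r x (t l).1 (t l).2) (coreCell L r c)}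

theorem le_two_mul_ncard_goodCells (hr : 0 < r) (hL : 4 * r < L) (hN : 40 ≤ N)
    (hNm : 24 * m ≤ N) (x : Fin n → ℝ × ℝ) (t : Fin m → Fin n × Fin n) :
    N ^ 2 ≤ 2 * (goodCells L r N x t).ncard := by
  have hcompl : (goodCells L r N x t)ᶜ =
      ⋃ l, {c | Cuts (region L r x (t l).1 (t l).2) (coreCell L r c)} := by
    ext c
    simp [goodCells]
  have hbad : (goodCells L r N x t)ᶜ.ncard ≤ m * (12 * N) := by
    calc (goodCells L r N x t)ᶜ.ncard
        ≤ ∑ l, {c : Fin N × Fin N |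
            Cuts (region L r x (t l).1 (t l).2) (coreCell L r c)}.ncard :=
          hcompl ▸ Set.ncard_iUnion_le_of_fintype _
      _ ≤ ∑ _l : Fin m, 12 * N :=
          Finset.sum_le_sum fun l _ => ncard_cuts_region_le hr hL hN x _ _
      _ = m * (12 * N) := by simp
  have htotal := Set.ncard_add_ncard_compl (goodCells L r N x t)
  rw [Nat.card_eq_fintype_card, Fintype.card_prod, Fintype.card_fin] at htotal
  have hmN : 24 * m * N ≤ N * N := Nat.mul_le_mul_right N hNm
  nlinarith

variable {x w : Fin n → ℝ × ℝ}

theorem coreVertices_resample (hw : ∀ i, w i ∈ core L r) :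
    coreVertices L r (resample (core L r) x w) = coreVertices L r x := by
  ext i
  by_cases hi : x i ∈ core L r
  · simp only [coreVertices, Set.mem_preimage, resample_of_mem w hi, hw, hi]
  · simp only [coreVertices, Set.mem_preimage, resample_of_notMem w hi]

theorem outerBall_resample (s : Fin n) (k : ℕ∞) :
    outerBall (torusGraph L r (resample (core L r) x w)) (coreVertices L r x) s k =
      outerBall (torusGraph L r x) (coreVertices L r x) s k := by
  have hadj : ((torusGraph L r (resample (core L r) x w)).induce
      (coreVertices L r x)ᶜ).spanningCoe =
      ((torusGraph L r x).induce (coreVertices L r x)ᶜ).spanningCoe := by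
    ext u v
    simp only [spanningCoe_induce_adj]
    refine and_congr_right fun (hu : x u ∉ core L r) => and_congr_right fun
      (hv : x v ∉ core L r) => ?_
    simp only [torusGraph, resample_of_notMem w hu, resample_of_notMem w hv]
  rw [outerBall, hadj, outerBall]

theorem mem_region_iff_exists_adj {s i : Fin n} (hs : s ∉ coreVertices L r x)
    (hi : i ∈ coreVertices L r x) (k : ℕ) :
    w i ∈ region L r x s k ↔
      ∃ v ∈ outerBall (torusGraph L r (resample (core L r) x w)) (coreVertices L r x) s k,
        (torusGraph L r (resample (core L r) x w)).Adj v i := by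
  simp only [region, Set.mem_ofPred_eq, Set.exists_mem_image, outerBall_resample]
  refine exists_congr fun v => and_congr_right fun hv => ?_
  have hvI : v ∉ coreVertices L r x := notMem_of_mem_outerBall hs hv
  have hne : v ≠ i := (ne_of_mem_of_not_mem hi hvI).symm
  simp only [torusGraph, resample_of_mem (B := core L r) w hi,
    resample_of_notMem (B := core L r) w hvI, hne, ne_eq, not_false_eq_true, true_and]

theorem exists_region_imp_sameSignature (hr : 0 < r) (hL : 4 * r < L)
    (hw : ∀ i, w i ∈ core L r) (S : Finset (Fin n)) :
    ∃ k : Fin n → Fin n, ∀ i ∈ coreVertices L r x, i ∉ S → ∀ j ∈ coreVertices L r x, j ∉ S →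
      (∀ s ∈ S, (w i ∈ region L r x s (k s) ↔ w j ∈ region L r x s (k s))) →
      SameSignature (torusGraph L r (resample (core L r) x w)) S i j := by
  have hI := isClique_coreVertices hr hL (resample (core L r) x w)
  rw [coreVertices_resample hw] at hI
  obtain ⟨k, hk, hsig⟩ := exists_outerBall_imp_sameSignature hI S
  simp only [Fintype.card_fin] at hk
  refine ⟨fun s => ⟨k s, hk s⟩, fun i hi hiS j hj hjS h => hsig i hi hiS j hj hjS ?_⟩
  intro s hs hsI
  rw [← mem_region_iff_exists_adj hsI hi, ← mem_region_iff_exists_adj hsI hj]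
  exact h s hs

theorem mem_iff_mem_of_not_cuts {U Q : Set (ℝ × ℝ)} (h : ¬ Cuts U Q) {p q : ℝ × ℝ} (hp : p ∈ Q)
    (hq : q ∈ Q) : p ∈ U ↔ q ∈ U :=
  ⟨fun hpU => by_contra fun hqU => h ⟨⟨p, hp, hpU⟩, q, hq, hqU⟩,
    fun hqU => by_contra fun hpU => h ⟨⟨q, hq, hqU⟩, p, hp, hpU⟩⟩

theorem exists_subset_range_of_card_le {V : Type*} [Nonempty V] {S : Finset V}
    (hS : S.card ≤ m) : ∃ u : Fin m → V, (S : Set V) ⊆ Set.range u := by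
  classical
  refine ⟨fun l => if h : (l : ℕ) < S.card then S.equivFin.symm ⟨l, h⟩ else Classical.arbitrary V,
    fun s hs => ?_⟩
  exact ⟨⟨S.equivFin ⟨s, hs⟩, (S.equivFin ⟨s, hs⟩).isLt.trans_le hS⟩, by simp⟩

/-- The datum `t` lists the sensors and their distances from the core. It takes only `(n ^ 2) ^ m`
values, whatever the positions `w` of the core vertices are. -/
theorem exists_subsingleton_of_resolves [Nonempty (Fin n)] (hr : 0 < r) (hL : 4 * r < L)
    (hw : ∀ i, w i ∈ core L r) {S : Finset (Fin n)} (hS : S.card ≤ m)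
    (hres : Resolves (torusGraph L r (resample (core L r) x w)) S (coreVertices L r x)) :
    ∃ t : Fin m → Fin n × Fin n, ∀ c ∈ goodCells L r N x t,
      {i ∈ coreVertices L r x \ Set.range fun l => (t l).1 |
        w i ∈ coreCell L r c}.Subsingleton := by
  obtain ⟨k, hk⟩ := exists_region_imp_sameSignature hr hL hw S
  obtain ⟨u, hu⟩ := exists_subset_range_of_card_le hS
  refine ⟨fun l => (u l, k (u l)), ?_⟩
  rintro c hc i ⟨⟨hi, hiu⟩, hic⟩ j ⟨⟨hj, hju⟩, hjc⟩
  refine hres i hi j hj (hk i hi (fun h => hiu (hu h)) j hj (fun h => hju (hu h)) fun s hs => ?_)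
  obtain ⟨l, rfl⟩ := hu hs
  exact mem_iff_mem_of_not_cuts (hc l) hic hjc

end Core

section Law

variable {n N m M : ℕ} {L r : ℝ}

theorem volume_core (L : ℝ) (hr : 0 ≤ r) :
    volume (core L r) = ENNReal.ofReal ((2 * r / 5) ^ 2) := by
  rw [core, Measure.volume_eq_prod, Measure.prod_prod, Real.volume_Ico,
    ← ENNReal.ofReal_mul (by linarith)]
  ring_nf

theorem volume_coreCell (L : ℝ) (hr : 0 ≤ r) (c : Fin N × Fin N) :
    volume (coreCell L r c) = ENNReal.ofReal ((2 * r / 5 / N) ^ 2) := by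
  rw [coreCell, gridCell, gridStrip, gridStrip, Measure.volume_eq_prod, Measure.prod_prod,
    Real.volume_Ico, Real.volume_Ico, ← ENNReal.ofReal_mul (by ring_nf; positivity)]
  ring_nf

theorem cond_core_real_coreCell (L : ℝ) (hr : 0 < r) (c : Fin N × Fin N) :
    (volume[|core L r]).real (coreCell L r c) = 1 / (N : ℝ) ^ 2 := by
  have hN : (0 : ℝ) < N := by exact_mod_cast c.1.pos
  rw [measureReal_def, cond_apply (measurableSet_core L r),
    Set.inter_eq_self_of_subset_right (coreCell_subset_core hr.le c), volume_core L hr.le,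
    volume_coreCell L hr.le, ENNReal.toReal_mul, ENNReal.toReal_inv,
    ENNReal.toReal_ofReal (by positivity), ENNReal.toReal_ofReal (by positivity)]
  field_simp

theorem core_subset_square (hr : 0 < r) (hL : 4 * r < Real.sqrt n) :
    core (Real.sqrt n) r ⊆ square n := by
  have hside : Set.Ico (Real.sqrt n / 2 - r / 5) (Real.sqrt n / 2 + r / 5) ⊆
      Set.Icc 0 (Real.sqrt n) := fun t ht => ⟨by linarith [ht.1], by linarith [ht.2]⟩
  exact Set.prod_mono hside hside

theorem measurableSet_square (n : ℕ) : MeasurableSet (square n) :=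
  measurableSet_Icc.prod measurableSet_Icc

theorem volume_square (n : ℕ) : volume (square n) = n := by
  rw [square, Measure.volume_eq_prod, Measure.prod_prod, Real.volume_Icc, sub_zero,
    ← ENNReal.ofReal_mul (Real.sqrt_nonneg _), Real.mul_self_sqrt (Nat.cast_nonneg n),
    ENNReal.ofReal_natCast]

theorem isProbabilityMeasure_cond_square (hn : 0 < n) :
    IsProbabilityMeasure ((volume : Measure (ℝ × ℝ))[|square n]) :=
  cond_isProbabilityMeasure_of_finite (by simp [volume_square, hn.ne'])
    (by simp [volume_square])

theorem cond_square_real_core (hr : 0 < r) (hL : 4 * r < Real.sqrt n) :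
    ((volume : Measure (ℝ × ℝ))[|square n]).real (core (Real.sqrt n) r) =
      (2 * r / 5) ^ 2 / n := by
  rw [measureReal_def, cond_apply (measurableSet_square n),
    Set.inter_eq_self_of_subset_right (core_subset_square hr hL), volume_core _ hr.le,
    volume_square, ENNReal.toReal_mul, ENNReal.toReal_inv, ENNReal.toReal_natCast,
    ENNReal.toReal_ofReal (by positivity), inv_mul_eq_div]

theorem cond_square_core_ne_zero (hr : 0 < r) (hL : 4 * r < Real.sqrt n) :
    ((volume : Measure (ℝ × ℝ))[|square n]) (core (Real.sqrt n) r) ≠ 0 := by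
  have hn : (0 : ℝ) < n := Real.sqrt_pos.1 (by linarith)
  refine fun h => (div_pos (pow_pos (by positivity : 0 < 2 * r / 5) 2) hn).ne' ?_
  rw [← cond_square_real_core hr hL, Measure.real, h, ENNReal.toReal_zero]

theorem cond_square_cond_core (hr : 0 < r) (hL : 4 * r < Real.sqrt n) :
    (volume : Measure (ℝ × ℝ))[|square n][|core (Real.sqrt n) r] =
      volume[|core (Real.sqrt n) r] := by
  rw [cond_cond_eq_cond_inter' (measurableSet_square n) (measurableSet_core _ _)
    (by simp [volume_square]), Set.inter_eq_self_of_subset_right (core_subset_square hr hL)]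

theorem pointsLaw_few_core_le (hr : 0 < r) (hL : 4 * r < Real.sqrt n) (T : ℝ) :
    pointsLaw n {x | ((coreVertices (Real.sqrt n) r x).ncard : ℝ) < T} ≤
      ENNReal.ofReal (Real.exp (T * Real.log 2 - (2 * r / 5) ^ 2 / 2)) := by
  have hn : (0 : ℝ) < n := Real.sqrt_pos.1 (by linarith)
  have := isProbabilityMeasure_cond_square (n := n) (by exact_mod_cast hn)
  have hcount := measureReal_ncard_lt_le (ι := Fin n) ((volume : Measure (ℝ × ℝ))[|square n])
    (measurableSet_core (Real.sqrt n) r) T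
  rw [cond_square_real_core hr hL, Fintype.card_fin, mul_div_cancel₀ _ hn.ne'] at hcount
  rw [pointsLaw, ← ofReal_measureReal]
  exact ENNReal.ofReal_le_ofReal hcount

theorem measurableSet_of_finite_family {α ι : Type*} [MeasurableSpace α] [Finite ι]
    {P : ι → α → Prop} (hP : ∀ i, MeasurableSet {x | P i x}) {E : Set α}
    (hE : ∀ x y, (∀ i, P i x ↔ P i y) → x ∈ E → y ∈ E) : MeasurableSet E := by
  let F (x : α) (i : ι) : Prop := P i x
  have hF : Measurable F := measurable_pi_lambda _ fun i => measurableSet_setOfPred.1 (hP i)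
  have hpre : E = F ⁻¹' (F '' E) := by
    refine Set.Subset.antisymm (Set.subset_preimage_image _ _) ?_
    rintro y ⟨x, hx, hxy⟩
    exact hE x y (fun i => iff_of_eq (congrFun hxy i)) hx
  rw [hpre]
  exact hF (Set.toFinite _).measurableSet

theorem measurable_torusDist_apply (i j : Fin n) :
    Measurable fun x : Fin n → ℝ × ℝ => torusDist L (x i) (x j) := by
  have hnorm : Measurable fun t : ℝ => ‖(t : AddCircle L)‖ :=
    (continuous_norm.comp (AddCircle.continuous_mk' L)).measurable
  have hfst : Measurable fun x : Fin n → ℝ × ℝ => (x i).1 - (x j).1 := by fun_prop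
  have hsnd : Measurable fun x : Fin n → ℝ × ℝ => (x i).2 - (x j).2 := by fun_prop
  exact (((hnorm.comp hfst).pow_const 2).add ((hnorm.comp hsnd).pow_const 2)).sqrt

/-- The event that the core has at least `T` vertices and that they are resolved by some `m`
sensors. -/
def resolvable (n : ℕ) (L r : ℝ) (T m : ℕ) : Set (Fin n → ℝ × ℝ) :=
  {x | T ≤ (coreVertices L r x).ncard ∧
    ∃ S : Finset (Fin n), S.card ≤ m ∧ Resolves (torusGraph L r x) S (coreVertices L r x)}

theorem measurableSet_resolvable (n : ℕ) (L r : ℝ) (T m : ℕ) :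
    MeasurableSet (resolvable n L r T m) := by
  let P : (Fin n × Fin n) ⊕ Fin n → (Fin n → ℝ × ℝ) → Prop :=
    Sum.elim (fun e x => torusDist L (x e.1) (x e.2) ≤ r) fun i x => x i ∈ core L r
  refine measurableSet_of_finite_family (P := P) ?_ fun x y hxy hx => ?_
  · rintro (e | i)
    · exact measurableSet_le (measurable_torusDist_apply e.1 e.2) measurable_const
    · exact measurable_pi_apply i (measurableSet_core L r)
  · have hgraph : torusGraph L r x = torusGraph L r y := by
      ext i j
      exact and_congr_right fun _ => hxy (Sum.inl (i, j))
    have hcore : coreVertices L r x = coreVertices L r y := Set.ext fun i => hxy (Sum.inr i)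
    simpa only [resolvable, Set.mem_ofPred_eq, hgraph, hcore] using hx

theorem pi_cond_core_subsingleton_le (hr : 0 < r) (hL : 4 * r < L) (hN : 40 ≤ N)
    (hNm : 24 * m ≤ N) (hM : M ≤ 2 * N ^ 2) {x : Fin n → ℝ × ℝ}
    (hx : M + m ≤ (coreVertices L r x).ncard) (t : Fin m → Fin n × Fin n) :
    (Measure.pi fun _ : Fin n => (volume : Measure (ℝ × ℝ))[|core L r])
      {w | ∀ c ∈ goodCells L r N x t, {i ∈ coreVertices L r x \ Set.range fun l => (t l).1 |
        w i ∈ coreCell L r c}.Subsingleton} ≤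
      ENNReal.ofReal (Real.exp (-(1 / (N : ℝ) ^ 2 * (M * (M - 1)) / 16))) := by
  classical
  have : (0 : ℝ) < N := by exact_mod_cast (show 0 < N by omega)
  have : IsProbabilityMeasure ((volume : Measure (ℝ × ℝ))[|core L r]) :=
    cond_isProbabilityMeasure_of_finite
      (by rw [volume_core L hr.le]; exact (ENNReal.ofReal_pos.2 (by positivity)).ne')
      (by rw [volume_core L hr.le]; exact ENNReal.ofReal_ne_top)
  have hgood : (N : ℝ) ^ 2 ≤ 2 * (goodCells L r N x t).ncard := by
    exact_mod_cast le_two_mul_ncard_goodCells hr hL hN hNm x t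
  have hM' : (M : ℝ) ≤ 2 * (N : ℝ) ^ 2 := by exact_mod_cast hM
  have hJ : M ≤ (coreVertices L r x \ Set.range fun l => (t l).1).ncard := by
    have hrange : (Set.range fun l => (t l).1).ncard ≤ m := by
      rw [← Set.image_univ]
      exact (Set.ncard_image_le).trans_eq (by simp)
    have := Set.le_ncard_sdiff (Set.range fun l => (t l).1) (coreVertices L r x)
    omega
  rw [Set.ncard_eq_toFinset_card'] at hJ hgood
  have hle := measureReal_collisionFree_le ((volume : Measure (ℝ × ℝ))[|core L r])
    (Q := coreCell L r) (Good := (goodCells L r N x t).toFinset) (q := 1 / (N : ℝ) ^ 2) (M := M)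
    ((gridCell_pairwise_disjoint _ _).set_pairwise _) (fun c _ => measurableSet_gridCell _ _ c)
    (fun c _ => cond_core_real_coreCell L hr c)
    (by rw [one_div_mul_eq_div, le_div_iff₀ (by positivity)]; linarith)
    (by rw [one_div_mul_eq_div, div_le_iff₀ (by positivity)]; exact hM') hJ
  simp only [Set.mem_toFinset, Set.coe_toFinset] at hle
  rw [← ofReal_measureReal]
  exact ENNReal.ofReal_le_ofReal hle

theorem pointsLaw_resolvable_le (hr : 0 < r) (hL : 4 * r < Real.sqrt n) (hN : 40 ≤ N)
    (hNm : 24 * m ≤ N) (hM : M ≤ 2 * N ^ 2) :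
    pointsLaw n (resolvable n (Real.sqrt n) r (M + m) m) ≤ ENNReal.ofReal
      (((n : ℝ) * n) ^ m * Real.exp (-(1 / (N : ℝ) ^ 2 * (M * (M - 1)) / 16))) := by
  have hn : 0 < n := by exact_mod_cast Real.sqrt_pos.1 (by linarith : 0 < Real.sqrt n)
  have : Nonempty (Fin n) := ⟨⟨0, hn⟩⟩
  have := isProbabilityMeasure_cond_square hn
  set δ := Real.exp (-(1 / (N : ℝ) ^ 2 * (M * (M - 1)) / 16))
  refine measure_le_of_resample_le _ (measurableSet_core (Real.sqrt n) r)
    (cond_square_core_ne_zero hr hL) (measurableSet_resolvable _ _ _ _ _) fun x => ?_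
  rw [cond_square_cond_core hr hL]
  set μ := Measure.pi fun _ : Fin n => (volume : Measure (ℝ × ℝ))[|core (Real.sqrt n) r]
  have hcore : ∀ᵐ w ∂μ, ∀ i, w i ∈ core (Real.sqrt n) r :=
    ae_all_iff.2 fun i => Measure.tendsto_eval_ae_ae.eventually
      (ae_cond_mem (measurableSet_core (Real.sqrt n) r))
  by_cases hx : M + m ≤ (coreVertices (Real.sqrt n) r x).ncard
  · calc μ {w | resample (core (Real.sqrt n) r) x w ∈ resolvable n (Real.sqrt n) r (M + m) m}
        ≤ μ (⋃ t : Fin m → Fin n × Fin n, {w | ∀ c ∈ goodCells (Real.sqrt n) r N x t,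
            {i ∈ coreVertices (Real.sqrt n) r x \ Set.range fun l => (t l).1 |
              w i ∈ coreCell (Real.sqrt n) r c}.Subsingleton}) := by
          refine measure_mono_ae ?_
          filter_upwards [hcore] with w hw ⟨_, S, hS, hres⟩
          rw [coreVertices_resample hw] at hres
          exact Set.mem_iUnion.2 (exists_subsingleton_of_resolves hr hL hw hS hres)
      _ ≤ ∑ _t : Fin m → Fin n × Fin n, ENNReal.ofReal δ :=
          (measure_iUnion_fintype_le _ _).trans (Finset.sum_le_sum fun t _ =>
            pi_cond_core_subsingleton_le hr hL hN hNm hM hx t)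
      _ = ENNReal.ofReal (((n : ℝ) * n) ^ m * δ) := by
          rw [Finset.sum_const, ← ENNReal.ofReal_nsmul, nsmul_eq_mul, Finset.card_univ,
            Fintype.card_fun, Fintype.card_prod, Fintype.card_fin, Fintype.card_fin]
          push_cast
          rfl
  · refine (measure_mono_null_ae ?_ (measure_empty (μ := μ))).le.trans zero_le
    filter_upwards [hcore] with w hw hres
    exact hx (coreVertices_resample hw ▸ hres.1)

end Law

section Parameters

variable {κ l ρ : ℝ}

theorem rpow_div_rpow_pow_three_mul (hl : 0 < l) (hρ : 0 ≤ ρ) :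
    (ρ ^ ((4 : ℝ) / 3) / l ^ ((1 : ℝ) / 3)) ^ 3 * l = ρ ^ 4 := by
  have hρ₃ : (ρ ^ ((4 : ℝ) / 3)) ^ 3 = ρ ^ 4 := by
    rw [← Real.rpow_mul_natCast hρ, ← Real.rpow_natCast]
    norm_num
  have hl₃ : (l ^ ((1 : ℝ) / 3)) ^ 3 = l := by
    rw [← Real.rpow_mul_natCast hl.le]
    norm_num
  rw [div_pow, hρ₃, hl₃, div_mul_cancel₀ _ hl.ne']

theorem le_of_pow_three_mul_eq_pow_four (hl : 0 < l) (hlρ : l ≤ ρ) (hκ : κ ^ 3 * l = ρ ^ 4) :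
    ρ ≤ κ := by
  have hρ : 0 < ρ := hl.trans_le hlρ
  refine le_of_not_gt fun hlt => hκ.not_lt ?_
  calc κ ^ 3 * l < ρ ^ 3 * l := by
        have : κ ^ 3 < ρ ^ 3 := (Odd.strictMono_pow (by decide : Odd 3)) hlt
        gcongr
    _ ≤ ρ ^ 3 * ρ := by gcongr
    _ = ρ ^ 4 := by ring

theorem le_sq_of_pow_three_mul_eq_pow_four (hl : 1 ≤ l) (hρ : 1 ≤ ρ) (hκ : κ ^ 3 * l = ρ ^ 4) :
    κ ≤ ρ ^ 2 := by
  refine le_of_not_gt fun hlt => hκ.not_gt ?_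
  have hlt₃ : (ρ ^ 2) ^ 3 < κ ^ 3 := pow_lt_pow_left₀ hlt (by positivity) (by norm_num)
  calc ρ ^ 4 ≤ ρ ^ 6 := pow_le_pow_right₀ hρ (by norm_num)
    _ = (ρ ^ 2) ^ 3 := by ring
    _ < κ ^ 3 := hlt₃
    _ ≤ κ ^ 3 * l := le_mul_of_one_le_right ((by positivity : 0 ≤ (ρ ^ 2) ^ 3).trans hlt₃.le) hl

theorem few_core_exponent_le {T : ℝ} (hρ : 50 ≤ ρ) (hlρ : l ≤ ρ) (hT : T ≤ 3 * ρ ^ 2 / 50) :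
    T * Real.log 2 - (2 * ρ / 5) ^ 2 / 2 ≤ -l := by
  have hlog : Real.log 2 ≤ 7 / 10 := by linarith [Real.log_two_lt_d9]
  have hTlog : T * Real.log 2 ≤ 3 * ρ ^ 2 / 50 * (7 / 10) := by
    calc T * Real.log 2 ≤ 3 * ρ ^ 2 / 50 * Real.log 2 := by gcongr
      _ ≤ 3 * ρ ^ 2 / 50 * (7 / 10) := by gcongr
  nlinarith

theorem resolvable_exponent_le {m M N : ℝ} (hl : 0 < l) (hρ : 100 ≤ ρ) (hκ₆ : 10 ^ 6 ≤ κ)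
    (hκ : κ ^ 3 * l = ρ ^ 4) (hm : m ≤ κ / 10 ^ 4 + 1) (hN₀ : 0 < N) (hN : N ≤ 2 * κ / 5 + 1)
    (hM : ρ ^ 2 / 20 ≤ M) :
    m * (l + l) + -(1 / N ^ 2 * (M * (M - 1)) / 16) ≤ -l := by
  have hpairs : ρ ^ 4 / 500 ≤ M * (M - 1) := by
    have hρ₂ : 10 ^ 4 ≤ ρ ^ 2 := by nlinarith
    calc ρ ^ 4 / 500 ≤ ρ ^ 2 / 20 * (ρ ^ 2 / 20 - 1) := by nlinarith
      _ ≤ M * (M - 1) := mul_le_mul hM (by linarith) (by linarith) (by linarith)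
  have hcells : N ^ 2 ≤ 17 / 100 * κ ^ 2 := by
    calc N ^ 2 ≤ (2 * κ / 5 + 1) ^ 2 := by gcongr
      _ ≤ 17 / 100 * κ ^ 2 := by nlinarith
  have hcollisions : κ * l / 85 ≤ 1 / N ^ 2 * (M * (M - 1)) := by
    rw [one_div_mul_eq_div, le_div_iff₀ (by positivity)]
    calc κ * l / 85 * N ^ 2 ≤ κ * l / 85 * (17 / 100 * κ ^ 2) := by gcongr
      _ = ρ ^ 4 / 500 := by rw [← hκ]; ring
      _ ≤ M * (M - 1) := hpairs
  have hchoices : m * (l + l) ≤ (κ / 10 ^ 4 + 1) * (l + l) := by gcongr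
  nlinarith

end Parameters

section Conclusion

variable {n : ℕ} {κ ρ : ℝ}

theorem robberEvadesIn_of_notMem_resolvable {m T : ℕ} {K : ℝ} (hρ : 0 < ρ)
    (hL : 4 * ρ < Real.sqrt n) (hK : K ≤ m) {x : Fin n → ℝ × ℝ}
    (hT : T ≤ (coreVertices (Real.sqrt n) ρ x).ncard)
    (hx : x ∉ resolvable n (Real.sqrt n) ρ T m) :
    RobberEvadesIn (torusGraph (Real.sqrt n) ρ x) K (centralBall (ρ / 3) x) := by
  have hn : 0 < n := by exact_mod_cast Real.sqrt_pos.1 (by linarith : 0 < Real.sqrt n)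
  have : Nonempty (Fin n) := ⟨⟨0, hn⟩⟩
  exact .of_isClique (coreVertices_subset_centralBall hρ hL x) (isClique_coreVertices hρ hL x)
    fun S hS hres => hx ⟨hT, S, by exact_mod_cast hS.le.trans hK, hres⟩

theorem pointsLaw_not_robberEvadesIn_le {m T : ℕ} {K : ℝ} (hρ : 0 < ρ)
    (hL : 4 * ρ < Real.sqrt n) (hK : K ≤ m) :
    pointsLaw n {x | RobberEvadesIn (torusGraph (Real.sqrt n) ρ x) K (centralBall (ρ / 3) x)}ᶜ ≤
      pointsLaw n {x | ((coreVertices (Real.sqrt n) ρ x).ncard : ℝ) < T} +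
        pointsLaw n (resolvable n (Real.sqrt n) ρ T m) := by
  refine (measure_mono fun x hx => ?_).trans (measure_union_le _ _)
  by_contra h
  simp only [Set.mem_union, Set.mem_ofPred_eq, not_or, not_lt, Nat.cast_le] at h
  exact hx (robberEvadesIn_of_notMem_resolvable hρ hL hK h.1 h.2)

theorem pointsLaw_not_robberEvadesIn_le_two_div (hl : 10 ^ 6 ≤ Real.log n)
    (hlρ : Real.log n ≤ ρ) (hL : 4 * ρ < Real.sqrt n) (hκ : κ ^ 3 * Real.log n = ρ ^ 4) :
    pointsLaw n {x | RobberEvadesIn (torusGraph (Real.sqrt n) ρ x) (κ / 10 ^ 4)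
      (centralBall (ρ / 3) x)}ᶜ ≤ ENNReal.ofReal (2 / n) := by
  have hρ₆ : 10 ^ 6 ≤ ρ := hl.trans hlρ
  have hρκ : ρ ≤ κ := le_of_pow_three_mul_eq_pow_four (by linarith) hlρ hκ
  have hκρ : κ ≤ ρ ^ 2 := le_sq_of_pow_three_mul_eq_pow_four (by linarith) (by linarith) hκ
  have hn : (0 : ℝ) < n := Real.sqrt_pos.1 (by linarith)
  obtain ⟨hm, hm'⟩ : κ / 10 ^ 4 ≤ ⌈κ / 10 ^ 4⌉₊ ∧ (⌈κ / 10 ^ 4⌉₊ : ℝ) < κ / 10 ^ 4 + 1 :=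
    ⟨Nat.le_ceil _, Nat.ceil_lt_add_one (by linarith)⟩
  obtain ⟨hN, hN'⟩ : 2 * κ / 5 ≤ ⌈2 * κ / 5⌉₊ ∧ (⌈2 * κ / 5⌉₊ : ℝ) < 2 * κ / 5 + 1 :=
    ⟨Nat.le_ceil _, Nat.ceil_lt_add_one (by linarith)⟩
  obtain ⟨hM, hM'⟩ : ρ ^ 2 / 20 ≤ ⌈ρ ^ 2 / 20⌉₊ ∧ (⌈ρ ^ 2 / 20⌉₊ : ℝ) < ρ ^ 2 / 20 + 1 :=
    ⟨Nat.le_ceil _, Nat.ceil_lt_add_one (by positivity)⟩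
  set m := ⌈κ / 10 ^ 4⌉₊
  set N := ⌈2 * κ / 5⌉₊
  set M := ⌈ρ ^ 2 / 20⌉₊
  have hfew := (pointsLaw_few_core_le (by linarith) hL (M + m : ℕ)).trans <|
    ENNReal.ofReal_le_ofReal <| Real.exp_le_exp.2 <|
      few_core_exponent_le (by linarith) hlρ (by push_cast; nlinarith)
  have hres : pointsLaw n (resolvable n (Real.sqrt n) ρ (M + m) m) ≤
      ENNReal.ofReal (Real.exp (-Real.log n)) := by
    refine (pointsLaw_resolvable_le (N := N) (by linarith) hL ?_ ?_ ?_).trans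
      (ENNReal.ofReal_le_ofReal ?_)
    · exact_mod_cast (by linarith : (40 : ℝ) ≤ N)
    · exact_mod_cast (by linarith : (24 : ℝ) * m ≤ N)
    · exact_mod_cast (by nlinarith : (M : ℝ) ≤ 2 * N ^ 2)
    · have hpow : ((n : ℝ) * n) ^ m = Real.exp (m * (Real.log n + Real.log n)) := by
        rw [Real.exp_nat_mul, Real.exp_add, Real.exp_log hn]
      rw [hpow, ← Real.exp_add, Real.exp_le_exp]
      exact resolvable_exponent_le (by linarith) (by linarith) (hρ₆.trans hρκ) hκ hm'.le
        (by linarith) hN'.le hM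
  refine (pointsLaw_not_robberEvadesIn_le (by linarith) hL hm).trans
    ((add_le_add hfew hres).trans_eq ?_)
  rw [← ENNReal.ofReal_add (by positivity) (by positivity), Real.exp_neg, Real.exp_log hn]
  ring_nf

theorem isProbabilityMeasure_pointsLaw (hn : 0 < n) : IsProbabilityMeasure (pointsLaw n) := by
  have := isProbabilityMeasure_cond_square hn
  unfold pointsLaw
  infer_instance

theorem tendsto_measure_one_of_tendsto_measure_compl_zero {ι : Type*} {f : Filter ι}
    {Ω : ι → Type*} [∀ i, MeasurableSpace (Ω i)] {μ : ∀ i, Measure (Ω i)} {s : ∀ i, Set (Ω i)}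
    (hμ : ∀ᶠ i in f, IsProbabilityMeasure (μ i))
    (h : Tendsto (fun i => μ i (s i)ᶜ) f (𝓝 0)) : Tendsto (fun i => μ i (s i)) f (𝓝 1) := by
  have hlim : Tendsto (fun i => 1 - μ i (s i)ᶜ) f (𝓝 1) := by
    simpa using ENNReal.Tendsto.sub tendsto_const_nhds h (Or.inl ENNReal.one_ne_top)
  refine tendsto_of_tendsto_of_tendsto_of_le_of_le' hlim tendsto_const_nhds ?_ ?_
  · filter_upwards [hμ] with i hi
    rw [tsub_le_iff_right, ← measure_univ (μ := μ i), ← Set.union_compl_self (s i)]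
    exact measure_union_le _ _
  · filter_upwards [hμ] with i hi using prob_le_one

end Conclusion

end LocalizationGame

end

theorem mainTheorem2 (r : ℕ → ℝ)
    (hr : ∀ᶠ n : ℕ in atTop, Real.log n ≤ r n ∧ r n < Real.sqrt n / 4) :
    Tendsto
      (fun n : ℕ => LocalizationGame.pointsLaw n
        {x | LocalizationGame.RobberEvadesIn
          (LocalizationGame.torusGraph (Real.sqrt n) (r n) x)
          ((10 : ℝ) ^ (-4 : ℤ) * r n ^ ((4 : ℝ) / 3) / Real.log n ^ ((1 : ℝ) / 3))
          (LocalizationGame.centralBall (r n / 3) x)})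
      atTop (𝓝 1) := by
  have hlog : Tendsto (fun n : ℕ => Real.log n) atTop atTop :=
    Real.tendsto_log_atTop.comp tendsto_natCast_atTop_atTop
  have hsmall : Tendsto (fun n : ℕ => ENNReal.ofReal (2 / n)) atTop (𝓝 0) := by
    simpa using ENNReal.tendsto_ofReal (tendsto_const_div_atTop_nhds_zero_nat 2)
  refine LocalizationGame.tendsto_measure_one_of_tendsto_measure_compl_zero
    ((eventually_gt_atTop 0).mono fun n hn => LocalizationGame.isProbabilityMeasure_pointsLaw hn)
    (tendsto_of_tendsto_of_tendsto_of_le_of_le' tendsto_const_nhds hsmall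
      (Eventually.of_forall fun _ => zero_le) ?_)
  filter_upwards [hr, hlog.eventually_ge_atTop (10 ^ 6)] with n ⟨hlogr, hrn⟩ hn
  have hbound : (10 : ℝ) ^ (-4 : ℤ) * r n ^ ((4 : ℝ) / 3) / Real.log n ^ ((1 : ℝ) / 3) =
      r n ^ ((4 : ℝ) / 3) / Real.log n ^ ((1 : ℝ) / 3) / 10 ^ 4 := by
    ring
  rw [hbound]
  exact LocalizationGame.pointsLaw_not_robberEvadesIn_le_two_div hn hlogr (by linarith)
    (LocalizationGame.rpow_div_rpow_pow_three_mul (by linarith) (by linarith))
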